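/- Let $\mathcal H$ be a real Hilbert space (for instance $\mathbb R^n$) and let $D:\mathcal H\to\mathcal H$ (the denoiser $D_\sigma$), with residual $R=I-D$, satisfy: - (homogeneity) $D(cx)=c\,D(x)$ for all $c>0$, $x\in\mathcal H$; - (nonexpansive residual) $\|R(x)-R(y)\|\le\|x-y\|$ for all $x,y\in\mathcal H$; - (symmetric Jacobian) at every $x\neq 0$, $D$ is Fréchet differentiable and its derivative is symmetric (self-adjoint); - (convex RED) $g(x)=\tfrac12\langle x,x-D(x)\rangle$ is convex. For $h:\mathcal H\to\mathbb R\cup\{+\infty\}$ write $h^*$ for its Fenchel conjugate, $\partial h$ for its subdifferential and $\mathrm{prox}_h(x)=\arg\min_u \tfrac12\|u-x\|^2+h(u)$. Call a proper convex lower semicontinuous $\phi:\mathcal H\to\mathbb R\cup\{+\infty\}$ an implicit regularization of $D$ if $R=\mathrm{prox}_{\phi^*}$ and $D=\mathrm{prox}_\phi$. Then $D$ has an implicit regularization with values in $[0,+\infty]$. Moreover, let $\phi$ be any implicit regularization of $D$, let $f:\mathcal H\to\mathbb R\cup\{+\infty\}$ be proper, convex and lower semicontinuous, let $\lambda,\tau,s>0$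 with $\tau s=1$, and define on $\mathcal H\times\mathcal H$ $$\mathcal A=\begin{pmatrix}\lambda\,\partial f& I\\ -I&\partial\phi^*\end{pmatrix},\qquad \mathcal M=\begin{pmatrix}\frac1\tau I&-I\\ -I&\frac1s I\end{pmatrix},\qquad \mathcal T=(\mathcal M+\mathcal A)^{-1}\mathcal M,\qquad \|u\|_{\mathcal M}=\sqrt{\langle \mathcal M u,u\rangle},$$ and assume that the inclusion $0\in\mathcal A u$ has a solution. Then the following hold. 1. (GraRED-P³) Let $\lambda_k\in[0,2]$ with $0<\inf_k\lambda_k\le\sup_k\lambda_k<2$, let $x^0,y^0\in\mathcal H$ be arbitrary, and for $k\ge 0$ let $$d^k=\mathrm{prox}_{\lambda f}(x^k-\tau y^k),\quad x^{k+1}=\lambda_k d^k+(1-\lambda_k)x^k,\quad y^{k+1}=\lambda_k R\big(y^k+s(2d^k-x^k)\big)+(1-\lambda_k)y^k .$$ Then there is a minimizer $x^*$ of the restoration problem $\min_{x\in\mathcal H}\lambda f(x)+\phi(x)$ such that $x^k$ converges weakly to $x^*$; if $\mathcal H$ is finite-dimensional, $x^k\to x^*$ in norm. 2. (GraRED-HP³)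 Let $\mu_k\in[0,1]$ with $\mu_k\to0$ and $\sum_k\mu_k=+\infty$, let $a=(x_a,y_a)\in\mathcal H\times\mathcal H$ and $x^0,y^0\in\mathcal H$ be arbitrary, and for $k\ge0$ let $$d^k=\mathrm{prox}_{\lambda f}(x^k-\tau y^k),\quad x^{k+1}=\mu_{k+1}x_a+(1-\mu_{k+1})d^k,$$ $$v^{k+1}=R\big(s(2d^k-x^k)+y^k\big),\quad y^{k+1}=\mu_{k+1}y_a+(1-\mu_{k+1})v^{k+1}.$$ Then there is a unique point $p=P^{\mathcal M}_{\mathrm{Fix}(\mathcal T)}(a)$ of $\mathrm{Fix}(\mathcal T)$ that minimizes $\|u-a\|_{\mathcal M}$ over $u\in\mathrm{Fix}(\mathcal T)$, it satisfies $0\in\mathcal A p$, and $x^k$ converges in norm to the first component of $p$. -/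

import Mathlib

open Filter Topology

namespace GraRED

noncomputable section

variable {H : Type*} [NormedAddCommGroup H] [InnerProductSpace ℝ H]

/-! ## Extended-real convex analysis on a real Hilbert space -/

/-- `f : H → ℝ ∪ {+∞}` is proper, convex and lower semicontinuous. Convexity is convexity of the
epigraph. -/
structure IsProperConvexLsc (f : H → EReal) : Prop where
  ne_bot : ∀ x, f x ≠ ⊥
  exists_ne_top : ∃ x, f x ≠ ⊤
  convex_epigraph : Convex ℝ {p : H × ℝ | f p.1 ≤ (p.2 : EReal)}
  lsc : LowerSemicontinuous f

/-- The Fenchel conjugate `f*(y) = sup_x (⟨x, y⟩ - f x)`. -/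
def conj (f : H → EReal) (y : H) : EReal :=
  ⨆ x : H, ((inner ℝ x y : ℝ) : EReal) - f x

/-- The subdifferential `∂f(x) = {v | f z ≥ f x + ⟨v, z - x⟩ for all z}`. -/
def subdiff (f : H → EReal) (x : H) : Set H :=
  {v | ∀ z : H, f x + ((inner ℝ v (z - x) : ℝ) : EReal) ≤ f z}

/-- `p` is a minimizer of `u ↦ ½‖u - x‖² + f u`. -/
def IsProx (f : H → EReal) (x p : H) : Prop :=
  IsMinOn (fun u : H => (((1 / 2 : ℝ) * ‖u - x‖ ^ 2 : ℝ) : EReal) + f u) Set.univ p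

/-- The proximal operator `prox_f`: the value at `x` is the minimizer of `u ↦ ½‖u - x‖² + f u`
(it exists and is unique when `f` is proper, convex, lower semicontinuous and `H` is complete). -/
def prox (f : H → EReal) (x : H) : H :=
  Classical.epsilon fun p => IsProx f x p

/-! ## Denoisers -/

/-- The RED functional `g(x) = ½⟨x, x - D x⟩` of a denoiser `D`. -/
def red (D : H → H) (x : H) : ℝ := 1 / 2 * inner ℝ x (x - D x)

/-- `φ` is an implicit regularization of the denoiser `D`: it is proper, convex, lower
semicontinuous, the residual `I - D` is `prox_{φ*}`, and `D` is `prox_φ`. -/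
structure IsImplicitReg (D : H → H) (φ : H → EReal) : Prop where
  proper : IsProperConvexLsc φ
  residual_prox : ∀ x, IsProx (conj φ) x (x - D x)
  denoiser_prox : ∀ x, IsProx φ x (D x)

/-! ## The restoration problem, the inclusion problem and the preconditioner -/

/-- `x` solves `min_x lam * f x + g x`. -/
def IsSolution (lam : ℝ) (f g : H → EReal) (x : H) : Prop :=
  IsMinOn (fun z => (lam : EReal) * f z + g z) Set.univ x

/-- The set-valued operator `A (x, y) = (lam ∂f(x) + y, -x + ∂g*(y))` on the Hilbert space
`H × H`. -/
def opA (lam : ℝ) (f g : H → EReal) (u : WithLp 2 (H × H)) : Set (WithLp 2 (H × H)) :=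
  {w | ∃ p ∈ subdiff f u.fst, ∃ q ∈ subdiff (conj g) u.snd,
    w = WithLp.toLp 2 (lam • p + u.snd, -u.fst + q)}

/-- The preconditioner `M (x, y) = (x / τ - y, -x + y / s)`. -/
def opM (τ s : ℝ) (u : WithLp 2 (H × H)) : WithLp 2 (H × H) :=
  WithLp.toLp 2 (τ⁻¹ • u.fst - u.snd, -u.fst + s⁻¹ • u.snd)

/-- The set-valued operator `T = (M + A)⁻¹ M`: `v ∈ T u` iff `M u ∈ M v + A v`. -/
def opT {E : Type*} [AddCommGroup E] (A : E → Set E) (M : E → E) (u : E) : Set E :=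
  {v | ∃ w ∈ A v, M u = M v + w}

/-- The fixed points of a set-valued operator. -/
def fixSet {E : Type*} (T : E → Set E) : Set E := {u | u ∈ T u}

/-- The seminorm `‖u‖_M = √⟨M u, u⟩`. -/
def seminormM {E : Type*} [NormedAddCommGroup E] [InnerProductSpace ℝ E] (M : E → E) (u : E) : ℝ :=
  Real.sqrt (inner ℝ (M u) u)

/-- `p` is the `M`-projection of `a` onto `S`: the unique point of `S` that minimizes
`‖u - a‖_M` over `u ∈ S`. -/
def IsMProj {E : Type*} [NormedAddCommGroup E] [InnerProductSpace ℝ E]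
    (M : E → E) (S : Set E) (a p : E) : Prop :=
  (p ∈ S ∧ ∀ u ∈ S, seminormM M (p - a) ≤ seminormM M (u - a)) ∧
    ∀ q ∈ S, (∀ u ∈ S, seminormM M (q - a) ≤ seminormM M (u - a)) → q = p

/-! ## The two algorithms -/

/-- `(x k, y k)` is generated by GraRED-P³ with relaxation parameters `r k`. -/
def IsGraREDP3 (D : H → H) (f : H → EReal) (lam τ s : ℝ) (r : ℕ → ℝ) (x y : ℕ → H) : Prop :=
  ∀ k, ∃ d, d = prox (fun z => (lam : EReal) * f z) (x k - τ • y k) ∧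
    x (k + 1) = r k • d + (1 - r k) • x k ∧
    y (k + 1) = r k • ((y k + s • ((2 : ℝ) • d - x k)) - D (y k + s • ((2 : ℝ) • d - x k)))
      + (1 - r k) • y k

/-- `(x k, y k)` is generated by GraRED-HP³ with anchor point `(xa, ya)` and anchor
coefficients `μ k`. -/
def IsGraREDHP3 (D : H → H) (f : H → EReal) (lam τ s : ℝ) (μ : ℕ → ℝ) (xa ya : H)
    (x y : ℕ → H) : Prop :=
  ∀ k, ∃ d v, d = prox (fun z => (lam : EReal) * f z) (x k - τ • y k) ∧
    x (k + 1) = μ (k + 1) • xa + (1 - μ (k + 1)) • d ∧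
    v = (s • ((2 : ℝ) • d - x k) + y k) - D (s • ((2 : ℝ) • d - x k) + y k) ∧
    y (k + 1) = μ (k + 1) • ya + (1 - μ (k + 1)) • v

end

end GraRED

namespace GraRED

variable {H : Type*} [NormedAddCommGroup H] [InnerProductSpace ℝ H]

/-! ## Subdifferentials and proximal points of extended-real functions -/

/-! Write `J` for the proximal map of `lam * f` and put `z = x - τ y`. Homogeneity of `D`, together
with `τ s = 1`, lets `τ` pass through the residual (`smul_residual`), so both algorithms collapse to
one-variable iterations of the Douglas–Rachford operator `G z = z - J z + D (2 J z - z)`, relaxed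
for P³ and Halpern for HP³ (the two `reduced` lemmas). `G` is firmly nonexpansive because `J` and
`D` are.

For P³, Fejér monotonicity, `douglasRachford_demiclosed` and Opial's argument give weak convergence
of the shadows `J z`; the main iterate is a relaxation of these shadows and inherits the limit. For
HP³, `douglasRachford_halpern` gives norm convergence of `z` to the projection `q` of `xa - τ ya`
onto the fixed points of `G`, and `x` then tends to `J q`.

It remains to identify `J q`. The fixed points of `G` are the differences `x - y` over zeros `(x,
y)` of the inclusion, whereas the seminorm of `M` measures `x - τ y`. Zeros form a product of a
primal and a dual set (`IsSaddle.exchange`), and homogeneity makes differences in one factor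
orthogonal to the other (`inner_sub_eq_zero_of_homogeneous`). Minimizing the distance from `x - τ y`
to a point therefore separates into a primal and a dual projection, and the primal one does not
depend on `τ` (`exists_saddle_projection`).

The implicit regularization is the conjugate of `½‖·‖² - red D` minus `½‖·‖²`. Euler's identity and
symmetry make `I - D` the gradient of `red D`, so `½‖·‖² - red D` has gradient `D`, which is
monotone since the residual is nonexpansive. -/

theorem exists_real_eq {a : EReal} (h₁ : a ≠ ⊥) (h₂ : a ≠ ⊤) : ∃ r : ℝ, a = r :=
  ⟨a.toReal, (EReal.coe_toReal h₂ h₁).symm⟩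

theorem mem_subdiff_iff {f : H → EReal} (hbot : ∀ x, f x ≠ ⊥) {x v : H} {a : ℝ} (ha : f x = a) :
    v ∈ subdiff f x ↔ ∀ (z : H) (t : ℝ), f z = t → a + inner ℝ v (z - x) ≤ t := by
  constructor
  · intro h z t ht
    have := h z
    rw [ha, ht] at this
    exact_mod_cast this
  · intro h z
    by_cases hz : f z = ⊤
    · simp [hz]
    · obtain ⟨t, ht⟩ := exists_real_eq (hbot z) hz
      rw [ha, ht]
      exact_mod_cast h z t ht

theorem exists_real_of_mem_subdiff {f : H → EReal} (hbot : ∀ x, f x ≠ ⊥) (htop : ∃ x, f x ≠ ⊤)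
    {x v : H} (hv : v ∈ subdiff f x) : ∃ a : ℝ, f x = a := by
  refine exists_real_eq (hbot x) fun hx => ?_
  obtain ⟨z, hz⟩ := htop
  have := hv z
  rw [hx, EReal.top_add_coe, top_le_iff] at this
  exact hz this

theorem isProx_iff {E : Type*} [NormedAddCommGroup E] {f : E → EReal} (hbot : ∀ x, f x ≠ ⊥)
    {x p : E} {a : ℝ} (ha : f p = a) :
    IsProx f x p ↔ ∀ (z : E) (t : ℝ), f z = t →
      1 / 2 * ‖p - x‖ ^ 2 + a ≤ 1 / 2 * ‖z - x‖ ^ 2 + t := by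
  constructor
  · intro h z t ht
    have := h (Set.mem_univ z)
    simp only [Set.mem_ofPred_eq, ha, ht] at this
    exact_mod_cast this
  · intro h z _
    simp only [Set.mem_ofPred_eq]
    by_cases hz : f z = ⊤
    · rw [hz, EReal.coe_add_top]
      exact le_top
    · obtain ⟨t, ht⟩ := exists_real_eq (hbot z) hz
      rw [ha, ht]
      exact_mod_cast h z t ht

theorem IsProx.exists_real {E : Type*} [NormedAddCommGroup E] {f : E → EReal}
    (hbot : ∀ x, f x ≠ ⊥) (htop : ∃ x, f x ≠ ⊤) {x p : E} (h : IsProx f x p) : ∃ a : ℝ, f p = a := by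
  refine exists_real_eq (hbot p) fun hp => ?_
  obtain ⟨z, hz⟩ := htop
  have := h (Set.mem_univ z)
  simp only [Set.mem_ofPred_eq, hp, EReal.coe_add_top, top_le_iff] at this
  exact EReal.add_ne_top (EReal.coe_ne_top _) hz this

theorem isProx_of_mem_subdiff {f : H → EReal} (hbot : ∀ x, f x ≠ ⊥) (htop : ∃ x, f x ≠ ⊤)
    {x p : H} (h : x - p ∈ subdiff f p) : IsProx f x p := by
  obtain ⟨a, ha⟩ := exists_real_of_mem_subdiff hbot htop h
  rw [isProx_iff hbot ha]
  intro z t ht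
  have h1 := (mem_subdiff_iff hbot ha).1 h z t ht
  have h2 : ‖z - x‖ ^ 2 = ‖z - p‖ ^ 2 - 2 * inner ℝ (x - p) (z - p) + ‖p - x‖ ^ 2 := by
    rw [show z - x = (z - p) - (x - p) by abel, norm_sub_sq_real, real_inner_comm,
      norm_sub_rev x p]
  nlinarith [sq_nonneg ‖z - p‖]

theorem convex_combination_le {f : H → EReal}
    (hconv : Convex ℝ {p : H × ℝ | f p.1 ≤ (p.2 : EReal)}) {x y : H} {a b : ℝ}
    (hx : f x ≤ a) (hy : f y ≤ b) {t : ℝ} (h0 : 0 ≤ t) (h1 : t ≤ 1) :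
    f ((1 - t) • x + t • y) ≤ ((1 - t) * a + t * b : ℝ) :=
  hconv (x := (x, a)) hx (y := (y, b)) hy (sub_nonneg.2 h1) h0 (by ring)

/-- Used to let the step along a segment or ray tend to zero after division by that step. -/
theorem nonneg_of_forall_small {c k : ℝ} (h : ∀ t : ℝ, 0 < t → t ≤ 1 → 0 ≤ c + t * k) :
    0 ≤ c := by
  have h1 : Tendsto (fun t : ℝ => c + t * k) (𝓝[>] 0) (𝓝 (c + 0 * k)) :=
    Tendsto.mono_left (Continuous.tendsto (by fun_prop) 0) nhdsWithin_le_nhds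
  rw [zero_mul, add_zero] at h1
  refine ge_of_tendsto h1 ?_
  filter_upwards [Ioc_mem_nhdsGT (zero_lt_one (α := ℝ))] with t ht
  exact h t ht.1 ht.2

theorem IsProx.mem_subdiff {f : H → EReal} (hbot : ∀ x, f x ≠ ⊥) (htop : ∃ x, f x ≠ ⊤)
    (hconv : Convex ℝ {p : H × ℝ | f p.1 ≤ (p.2 : EReal)}) {x p : H} (h : IsProx f x p) :
    x - p ∈ subdiff f p := by
  obtain ⟨a, ha⟩ := h.exists_real hbot htop
  rw [mem_subdiff_iff hbot ha]
  intro z b hb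
  rw [isProx_iff hbot ha] at h
  suffices 0 ≤ (b - a - inner ℝ (x - p) (z - p)) by linarith
  refine nonneg_of_forall_small (k := 1 / 2 * ‖z - p‖ ^ 2) fun t ht0 ht1 => ?_
  have h1 := convex_combination_le hconv ha.le hb.le ht0.le ht1
  obtain ⟨c, hc⟩ := exists_real_eq (hbot ((1 - t) • p + t • z))
    (fun hh => by rw [hh] at h1; exact EReal.coe_ne_top _ (top_le_iff.1 h1))
  have h2 := h _ c hc
  rw [hc] at h1
  have h1' : c ≤ (1 - t) * a + t * b := by exact_mod_cast h1
  have h3 : ‖(1 - t) • p + t • z - x‖ ^ 2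
      = t ^ 2 * ‖z - p‖ ^ 2 - 2 * t * inner ℝ (x - p) (z - p) + ‖p - x‖ ^ 2 := by
    rw [show (1 - t) • p + t • z - x = t • (z - p) - (x - p) by module, norm_sub_sq_real,
      norm_smul, real_inner_smul_left, real_inner_comm, norm_sub_rev x p, mul_pow,
      Real.norm_eq_abs, sq_abs]
    ring
  have h4 : 0 ≤ t * (b - a - inner ℝ (x - p) (z - p) + t * (1 / 2 * ‖z - p‖ ^ 2)) := by
    rw [h3] at h2
    nlinarith
  exact nonneg_of_mul_nonneg_right h4 ht0

theorem subdiff_monotone {f : H → EReal} (hbot : ∀ x, f x ≠ ⊥) (htop : ∃ x, f x ≠ ⊤)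
    {x y v w : H} (hv : v ∈ subdiff f x) (hw : w ∈ subdiff f y) :
    0 ≤ (inner ℝ (v - w) (x - y) : ℝ) := by
  obtain ⟨a, ha⟩ := exists_real_of_mem_subdiff hbot htop hv
  obtain ⟨b, hb⟩ := exists_real_of_mem_subdiff hbot htop hw
  have h1 := (mem_subdiff_iff hbot ha).1 hv y b hb
  have h2 := (mem_subdiff_iff hbot hb).1 hw x a ha
  rw [inner_sub_left]
  rw [← neg_sub x y, inner_neg_right] at h1
  linarith

/-- Subdifferentials are paramonotone. -/
theorem mem_subdiff_of_inner_eq_zero {f : H → EReal} (hbot : ∀ x, f x ≠ ⊥)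
    (htop : ∃ x, f x ≠ ⊤) {x y v w : H} (hv : v ∈ subdiff f x) (hw : w ∈ subdiff f y)
    (h : (inner ℝ (v - w) (x - y) : ℝ) = 0) : w ∈ subdiff f x := by
  obtain ⟨a, ha⟩ := exists_real_of_mem_subdiff hbot htop hv
  obtain ⟨b, hb⟩ := exists_real_of_mem_subdiff hbot htop hw
  have h1 := (mem_subdiff_iff hbot ha).1 hv y b hb
  have hw' := (mem_subdiff_iff hbot hb).1 hw
  rw [inner_sub_left] at h
  rw [← neg_sub x y, inner_neg_right] at h1
  rw [mem_subdiff_iff hbot ha]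
  intro z t ht
  have h2 := hw' z t ht
  rw [show z - y = (z - x) + (x - y) by abel, inner_add_right] at h2
  linarith

theorem eq_of_mem_subdiff {f : H → EReal} (hbot : ∀ x, f x ≠ ⊥) (htop : ∃ x, f x ≠ ⊤)
    {x p q : H} (hp : x - p ∈ subdiff f p) (hq : x - q ∈ subdiff f q) : p = q := by
  have h := subdiff_monotone hbot htop hp hq
  rw [show x - p - (x - q) = -(p - q) by abel, inner_neg_left, real_inner_self_eq_norm_sq] at h
  have : ‖p - q‖ = 0 := by nlinarith [sq_nonneg ‖p - q‖]
  exact sub_eq_zero.1 (norm_eq_zero.1 this)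

theorem conj_ne_bot {f : H → EReal} (hbot : ∀ x, f x ≠ ⊥) (htop : ∃ x, f x ≠ ⊤) (y : H) :
    conj f y ≠ ⊥ := by
  obtain ⟨x, hx⟩ := htop
  obtain ⟨a, ha⟩ := exists_real_eq (hbot x) hx
  have h : ((inner ℝ x y : ℝ) : EReal) - f x ≤ conj f y :=
    le_iSup (fun x => ((inner ℝ x y : ℝ) : EReal) - f x) x
  rw [ha, ← EReal.coe_sub] at h
  exact fun hh => EReal.coe_ne_bot _ (le_bot_iff.1 (hh ▸ h))

theorem conj_eq_of_mem_subdiff {f : H → EReal} (hbot : ∀ x, f x ≠ ⊥) {x v : H} {a : ℝ}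
    (ha : f x = a) (hv : v ∈ subdiff f x) : conj f v = (inner ℝ x v - a : ℝ) := by
  apply le_antisymm
  · refine iSup_le fun z => ?_
    by_cases hz : f z = ⊤
    · simp [hz]
    · obtain ⟨t, ht⟩ := exists_real_eq (hbot z) hz
      have := (mem_subdiff_iff hbot ha).1 hv z t ht
      rw [inner_sub_right] at this
      rw [ht, ← EReal.coe_sub, EReal.coe_le_coe_iff, real_inner_comm v z, real_inner_comm v x]
      linarith
  · rw [EReal.coe_sub, ← ha]
    exact le_iSup (fun x => ((inner ℝ x v : ℝ) : EReal) - f x) x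

theorem mem_subdiff_conj {f : H → EReal} (hbot : ∀ x, f x ≠ ⊥) (htop : ∃ x, f x ≠ ⊤) {x v : H}
    (hv : v ∈ subdiff f x) : x ∈ subdiff (conj f) v := by
  obtain ⟨a, ha⟩ := exists_real_of_mem_subdiff hbot htop hv
  rw [mem_subdiff_iff (conj_ne_bot hbot htop) (conj_eq_of_mem_subdiff hbot ha hv)]
  intro z t ht
  have h : ((inner ℝ x z : ℝ) : EReal) - f x ≤ conj f z :=
    le_iSup (fun x => ((inner ℝ x z : ℝ) : EReal) - f x) x
  rw [ha, ht, ← EReal.coe_sub, EReal.coe_le_coe_iff] at h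
  rw [inner_sub_right]
  linarith

theorem IsProperConvexLsc.smul {f : H → EReal} (hf : IsProperConvexLsc f) {c : ℝ} (hc : 0 < c) :
    IsProperConvexLsc fun x => (c : EReal) * f x where
  ne_bot x := by
    by_cases hx : f x = ⊤
    · simp [hx, EReal.coe_mul_top_of_pos hc]
    · obtain ⟨a, ha⟩ := exists_real_eq (hf.ne_bot x) hx
      rw [ha, ← EReal.coe_mul]
      exact EReal.coe_ne_bot _
  exists_ne_top := by
    obtain ⟨x, hx⟩ := hf.exists_ne_top
    obtain ⟨a, ha⟩ := exists_real_eq (hf.ne_bot x) hx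
    refine ⟨x, ?_⟩
    rw [ha, ← EReal.coe_mul]
    exact EReal.coe_ne_top _
  convex_epigraph := by
    have key : ∀ (x : H) (t : ℝ), (c : EReal) * f x ≤ t ↔ f x ≤ (c⁻¹ * t : ℝ) := by
      intro x t
      by_cases hx : f x = ⊤
      · simp [hx, EReal.coe_mul_top_of_pos hc]
        exact_mod_cast EReal.coe_ne_top (c⁻¹ * t)
      · obtain ⟨a, ha⟩ := exists_real_eq (hf.ne_bot x) hx
        rw [ha, ← EReal.coe_mul, EReal.coe_le_coe_iff, EReal.coe_le_coe_iff, inv_mul_eq_div,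
          le_div_iff₀' hc]
    rintro ⟨x, s⟩ hx ⟨y, t⟩ hy a b ha hb hab
    simp only [Set.mem_ofPred_eq, key] at hx hy
    have := hf.convex_epigraph (x := (x, c⁻¹ * s)) hx (y := (y, c⁻¹ * t)) hy ha hb hab
    simp only [Set.mem_ofPred_eq, key, Prod.fst_add, Prod.smul_fst, Prod.snd_add, Prod.smul_snd,
      smul_eq_mul] at this ⊢
    convert this using 2
    ring
  lsc := by
    refine Continuous.comp_lowerSemicontinuous (g := fun y : EReal => (c : EReal) * y) ?_ hf.lsc ?_
    · rw [continuous_iff_continuousAt]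
      intro y
      exact EReal.Tendsto.const_mul tendsto_id (Or.inl (EReal.coe_ne_bot c)) (Or.inl (EReal.coe_ne_top c))
    · exact fun x y h => mul_le_mul_of_nonneg_left h (by exact_mod_cast hc.le)

theorem smul_mem_subdiff_iff {f : H → EReal} (hf : IsProperConvexLsc f) {c : ℝ} (hc : 0 < c)
    {x v : H} : c • v ∈ subdiff (fun z => (c : EReal) * f z) x ↔ v ∈ subdiff f x := by
  have hF := hf.smul hc
  have key : ∀ {z : H} {t : ℝ}, (c : EReal) * f z = (c * t : ℝ) ↔ f z = t := by
    intro z t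
    constructor
    · intro h
      by_cases hz : f z = ⊤
      · rw [hz, EReal.coe_mul_top_of_pos hc] at h
        exact absurd h.symm (EReal.coe_ne_top _)
      · obtain ⟨a, ha⟩ := exists_real_eq (hf.ne_bot z) hz
        rw [ha, ← EReal.coe_mul, EReal.coe_eq_coe_iff] at h
        rw [ha, mul_left_cancel₀ hc.ne' h]
    · intro h
      rw [h, EReal.coe_mul]
  constructor
  · intro h
    obtain ⟨b, hb⟩ := exists_real_of_mem_subdiff hF.ne_bot hF.exists_ne_top h
    have hb' : (c : EReal) * f x = (c * (c⁻¹ * b) : ℝ) := by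
      rw [hb, mul_inv_cancel_left₀ hc.ne']
    rw [mem_subdiff_iff hF.ne_bot hb'] at h
    rw [mem_subdiff_iff hf.ne_bot (key.1 hb')]
    intro z t ht
    have := h z _ (key.2 ht)
    rw [real_inner_smul_left, ← mul_add] at this
    exact le_of_mul_le_mul_left this hc
  · intro h
    obtain ⟨b, hb⟩ := exists_real_of_mem_subdiff hf.ne_bot hf.exists_ne_top h
    rw [mem_subdiff_iff hf.ne_bot hb] at h
    rw [mem_subdiff_iff hF.ne_bot (key.2 hb)]
    intro z t ht
    have ht' : (c : EReal) * f z = (c * (c⁻¹ * t) : ℝ) := by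
      rw [ht, mul_inv_cancel_left₀ hc.ne']
    have := mul_le_mul_of_nonneg_left (h z _ (key.1 ht')) hc.le
    rwa [mul_inv_cancel_left₀ hc.ne', mul_add, ← real_inner_smul_left] at this

theorem isSolution_of_mem_subdiff {f g : H → EReal} {lam : ℝ} (hlam : 0 < lam)
    (hf : IsProperConvexLsc f) (hg : IsProperConvexLsc g)
    {x v : H} (hv : v ∈ subdiff (fun z => (lam : EReal) * f z) x) (hw : -v ∈ subdiff g x) :
    IsSolution lam f g x := by
  have hF := hf.smul hlam
  intro z _
  have h1 := hv z
  have h2 := hw z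
  obtain ⟨a, ha⟩ := exists_real_of_mem_subdiff hF.ne_bot hF.exists_ne_top hv
  obtain ⟨b, hb⟩ := exists_real_of_mem_subdiff hg.ne_bot hg.exists_ne_top hw
  have h3 := add_le_add h1 h2
  simp only [Set.mem_ofPred_eq]
  refine le_trans (le_of_eq ?_) h3
  simp only [ha, hb, inner_neg_left]
  norm_cast
  ring

/-! ## Existence of proximal points -/

/-- A proper convex lower semicontinuous function has a minorant of linear growth. -/
theorem IsProperConvexLsc.exists_minorant {f : H → EReal} (hf : IsProperConvexLsc f) :
    ∃ (x₀ : H) (a C : ℝ), 0 ≤ C ∧ f x₀ = a ∧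
      ∀ (z : H) (t : ℝ), f z = t → a - 1 - C * ‖z - x₀‖ ≤ t := by
  obtain ⟨x₀, hx₀⟩ := hf.exists_ne_top
  obtain ⟨a, ha⟩ := exists_real_eq (hf.ne_bot x₀) hx₀
  have h1 : ∀ᶠ z in 𝓝 x₀, ((a - 1 : ℝ) : EReal) < f z := by
    refine hf.lsc x₀ _ ?_
    simp only [ha, gt_iff_lt, EReal.coe_lt_coe_iff]
    linarith
  obtain ⟨δ, hδ, hball⟩ := Metric.eventually_nhds_iff.1 h1
  -- A far point is pulled back along the segment to distance `δ / 2` from `x₀`, where `f > a - 1`;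
  -- the weight `θ` satisfies `1 / θ = (2 / δ) ‖z - x₀‖`, whence the slope.
  refine ⟨x₀, a, 2 / δ, by positivity, ha, fun z t ht => ?_⟩
  rcases lt_or_ge ‖z - x₀‖ δ with hz | hz
  · have := hball (y := z) (by rwa [dist_eq_norm])
    rw [ht, EReal.coe_lt_coe_iff] at this
    have : 0 ≤ 2 / δ * ‖z - x₀‖ := by positivity
    linarith
  · have hpos : 0 < ‖z - x₀‖ := hδ.trans_le hz
    set θ : ℝ := δ / (2 * ‖z - x₀‖) with hθ
    have hθ0 : 0 < θ := by positivity
    have hθ1 : θ ≤ 1 := by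
      rw [hθ, div_le_one (by positivity)]
      linarith
    have h2 := convex_combination_le hf.convex_epigraph ha.le ht.le hθ0.le hθ1
    have h3 := hball (y := (1 - θ) • x₀ + θ • z) (by
      rw [dist_eq_norm, show (1 - θ) • x₀ + θ • z - x₀ = θ • (z - x₀) by module, norm_smul,
        Real.norm_of_nonneg hθ0.le, hθ]
      field_simp
      linarith)
    have h4 := h3.trans_le h2
    rw [EReal.coe_lt_coe_iff] at h4
    have h5 : 2 / δ * ‖z - x₀‖ = 1 / θ := by
      rw [hθ]
      field_simp
    rw [h5]
    have h6 : -1 < θ * (t - a) := by linarith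
    have h7 : -(1 / θ) < t - a := by
      rw [← mul_lt_mul_iff_right₀ hθ0]
      have : θ * -(1 / θ) = -1 := by field_simp
      rwa [this]
    linarith

/-- The linear minorant bounds the objective below, the parallelogram identity makes a minimizing
sequence Cauchy, and lower semicontinuity makes its limit a minimizer. -/
theorem IsProperConvexLsc.exists_isProx [CompleteSpace H] {f : H → EReal}
    (hf : IsProperConvexLsc f) (x : H) : ∃ p, IsProx f x p := by
  obtain ⟨x₀, a, C, hC, ha, hmin⟩ := hf.exists_minorant
  set S : Set ℝ := {r | ∃ (z : H) (t : ℝ), f z = t ∧ r = 1 / 2 * ‖z - x‖ ^ 2 + t} with hS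
  have hne : S.Nonempty := ⟨_, x₀, a, ha, rfl⟩
  have hbdd : BddBelow S := by
    refine ⟨a - 1 - C * ‖x - x₀‖ - C ^ 2 / 2, ?_⟩
    rintro r ⟨z, t, ht, rfl⟩
    have h1 := hmin z t ht
    have h2 : ‖z - x₀‖ ≤ ‖z - x‖ + ‖x - x₀‖ := norm_sub_le_norm_sub_add_norm_sub z x x₀
    nlinarith [sq_nonneg (‖z - x‖ - C), mul_le_mul_of_nonneg_left h2 hC]
  set m := sInf S with hm
  have hseq : ∀ n : ℕ, ∃ (z : H) (t : ℝ), f z = t ∧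
      1 / 2 * ‖z - x‖ ^ 2 + t < m + 1 / ((n : ℝ) + 1) := by
    intro n
    obtain ⟨r, ⟨z, t, ht, rfl⟩, hr⟩ := exists_lt_of_csInf_lt hne
      (show sInf S < m + 1 / ((n : ℝ) + 1) by rw [← hm]; linarith [Nat.one_div_pos_of_nat (α := ℝ) (n := n)])
    exact ⟨z, t, ht, hr⟩
  choose u t hu ht using hseq
  have hlow : ∀ (z : H) (b : ℝ), f z ≤ b → m ≤ 1 / 2 * ‖z - x‖ ^ 2 + b := by
    intro z b hb
    obtain ⟨c, hc⟩ := exists_real_eq (hf.ne_bot z)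
      (fun h => by rw [h] at hb; exact EReal.coe_ne_top _ (top_le_iff.1 hb))
    rw [hc, EReal.coe_le_coe_iff] at hb
    have : m ≤ 1 / 2 * ‖z - x‖ ^ 2 + c := csInf_le hbdd ⟨z, c, hc, rfl⟩
    linarith
  have hcauchy : ∀ i j, ‖u i - u j‖ ^ 2 ≤ 4 * (1 / ((i : ℝ) + 1) + 1 / ((j : ℝ) + 1)) := by
    intro i j
    have h1 := hlow _ _ (convex_combination_le hf.convex_epigraph (hu i).le (hu j).le
      (t := 1 / 2) (by norm_num) (by norm_num))
    have h2 : ‖(1 - (1 / 2 : ℝ)) • u i + (1 / 2 : ℝ) • u j - x‖ ^ 2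
        = 1 / 2 * ‖u i - x‖ ^ 2 + 1 / 2 * ‖u j - x‖ ^ 2 - 1 / 4 * ‖u i - u j‖ ^ 2 := by
      have e1 : (1 - (1 / 2 : ℝ)) • u i + (1 / 2 : ℝ) • u j - x
          = (1 / 2 : ℝ) • ((u i - x) + (u j - x)) := by module
      have e2 : u i - u j = (u i - x) - (u j - x) := by abel
      rw [e1, e2, norm_smul, mul_pow, norm_add_sq_real (u i - x),
        norm_sub_sq_real (u i - x) (u j - x)]
      norm_num
      ring
    have h3 := ht i
    have h4 := ht j
    rw [h2] at h1
    linarith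
  have hinv : Tendsto (fun n : ℕ => 1 / ((n : ℝ) + 1)) atTop (𝓝 0) :=
    tendsto_one_div_add_atTop_nhds_zero_nat
  have hcs : CauchySeq u := by
    refine cauchySeq_of_le_tendsto_0' (fun n : ℕ => Real.sqrt (8 * (1 / ((n : ℝ) + 1)))) ?_ ?_
    · intro i j hij
      rw [dist_eq_norm]
      refine Real.le_sqrt_of_sq_le ((hcauchy i j).trans ?_)
      have : 1 / ((j : ℝ) + 1) ≤ 1 / ((i : ℝ) + 1) := Nat.one_div_le_one_div hij
      linarith
    · have := (hinv.const_mul 8).sqrt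
      simpa using this
  obtain ⟨p, hp⟩ := cauchySeq_tendsto_of_complete hcs
  have hval : ∀ c : ℝ, (c : EReal) < f p → c ≤ m - 1 / 2 * ‖p - x‖ ^ 2 := by
    intro c hc
    have h1 : ∀ᶠ n in atTop, (c : EReal) < f (u n) := hp.eventually (hf.lsc p c hc)
    have h2 : Tendsto (fun n : ℕ => m + 1 / ((n : ℝ) + 1) - 1 / 2 * ‖u n - x‖ ^ 2) atTop
        (𝓝 (m + 0 - 1 / 2 * ‖p - x‖ ^ 2)) :=
      (hinv.const_add m).sub (((hp.sub_const x).norm.pow 2).const_mul _)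
    rw [add_zero] at h2
    refine ge_of_tendsto h2 ?_
    filter_upwards [h1] with n hn
    rw [hu n, EReal.coe_lt_coe_iff] at hn
    linarith [ht n]
  have hle : f p ≤ (m - 1 / 2 * ‖p - x‖ ^ 2 : ℝ) := by
    refine EReal.ge_of_forall_gt_iff_ge.1 fun c hc => ?_
    exact_mod_cast hval c hc
  obtain ⟨b, hb⟩ := exists_real_eq (hf.ne_bot p)
    (fun h => by rw [h] at hle; exact EReal.coe_ne_top _ (top_le_iff.1 hle))
  refine ⟨p, (isProx_iff hf.ne_bot hb).2 fun z c hc => ?_⟩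
  rw [hb, EReal.coe_le_coe_iff] at hle
  linarith [hlow z c hc.le]

theorem IsProperConvexLsc.sub_prox_mem_subdiff [CompleteSpace H] {f : H → EReal}
    (hf : IsProperConvexLsc f) (x : H) : x - prox f x ∈ subdiff f (prox f x) :=
  IsProx.mem_subdiff hf.ne_bot hf.exists_ne_top hf.convex_epigraph
    (Classical.epsilon_spec (hf.exists_isProx x))

/-! ## Weak convergence -/

/-- Weak convergence of a family of vectors along a filter. -/
def WeakTendsto {ι : Type*} (x : ι → H) (l : Filter ι) (a : H) : Prop :=
  ∀ w, Tendsto (fun i => (inner ℝ w (x i) : ℝ)) l (𝓝 (inner ℝ w a))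

/-- Banach–Alaoglu transported by the Riesz isometry. Ultrafilters take the place of weakly
convergent subsequences, so no separability is involved. -/
theorem exists_weakTendsto [CompleteSpace H] {ι : Type*} (U : Ultrafilter ι) {x : ι → H} {C : ℝ}
    (hx : ∀ i, ‖x i‖ ≤ C) : ∃ a, WeakTendsto x U a := by
  let Φ : ι → WeakDual ℝ H := fun i => StrongDual.toWeakDual (InnerProductSpace.toDual ℝ H (x i))
  have hK := WeakDual.isCompact_closedBall (𝕜 := ℝ) (E := H) 0 C
  obtain ⟨φ, -, hφ⟩ := hK.ultrafilter_le_nhds (U.map Φ) (by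
    rw [le_principal_iff, Ultrafilter.coe_map, mem_map]
    refine univ_mem' fun i => ?_
    simp only [Set.mem_preimage, Metric.mem_closedBall, dist_zero_right]
    exact ((InnerProductSpace.toDual ℝ H).norm_map (x i)).trans_le (hx i))
  refine ⟨(InnerProductSpace.toDual ℝ H).symm (WeakDual.toStrongDual φ), fun w => ?_⟩
  have h1 : Tendsto Φ U (𝓝 φ) := hφ
  have h2 := ((WeakDual.eval_continuous w).tendsto φ).comp h1
  rw [real_inner_comm, InnerProductSpace.toDual_symm_apply]
  refine h2.congr fun i => ?_
  rw [real_inner_comm]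
  rfl

theorem weakTendsto_iff_ultrafilter {ι : Type*} {x : ι → H} {l : Filter ι} {a : H} :
    WeakTendsto x l a ↔ ∀ U : Ultrafilter ι, ↑U ≤ l → WeakTendsto x U a :=
  ⟨fun h _ hU w => (h w).mono_left hU,
    fun h w => (tendsto_iff_ultrafilter _ _ _).2 fun U hU => h U hU w⟩

theorem WeakTendsto.tendsto [FiniteDimensional ℝ H] {ι : Type*} {x : ι → H} {l : Filter ι} {a : H}
    (h : WeakTendsto x l a) : Tendsto x l (𝓝 a) := by
  let b := stdOrthonormalBasis ℝ H
  have h1 : Tendsto (fun i => ∑ j, (inner ℝ (b j) (x i) : ℝ) • b j) l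
      (𝓝 (∑ j, (inner ℝ (b j) a : ℝ) • b j)) :=
    tendsto_finsetSum _ fun j _ => (h (b j)).smul_const _
  simpa only [b.sum_repr'] using h1

/-! ## Firmly nonexpansive operators -/

/-- Firm nonexpansiveness: `‖T x - T y‖² ≤ ⟨T x - T y, x - y⟩`. -/
def FirmlyNonexpansive (T : H → H) : Prop :=
  ∀ x y, ‖T x - T y‖ ^ 2 ≤ inner ℝ (T x - T y) (x - y)

theorem FirmlyNonexpansive.norm_sub_le {T : H → H} (hT : FirmlyNonexpansive T) (x y : H) :
    ‖T x - T y‖ ≤ ‖x - y‖ := by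
  have h := (hT x y).trans (real_inner_le_norm _ _)
  rcases (norm_nonneg (T x - T y)).eq_or_lt with h0 | h0
  · rw [← h0]
    exact norm_nonneg _
  · rw [sq] at h
    exact le_of_mul_le_mul_left h h0

theorem FirmlyNonexpansive.tendsto {T : H → H} (hT : FirmlyNonexpansive T) {ι : Type*}
    {l : Filter ι} {x : ι → H} {a : H} (h : Tendsto x l (𝓝 a)) :
    Tendsto (fun i => T (x i)) l (𝓝 (T a)) := by
  rw [tendsto_iff_norm_sub_tendsto_zero] at h ⊢
  exact squeeze_zero (fun _ => norm_nonneg _) (fun i => hT.norm_sub_le _ _) h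

theorem FirmlyNonexpansive.sub_const {T : H → H} (hT : FirmlyNonexpansive T) (c : H) :
    FirmlyNonexpansive fun x => T (x - c) := fun x y => by
  have := hT (x - c) (y - c)
  rwa [sub_sub_sub_cancel_right] at this

theorem FirmlyNonexpansive.inner_nonneg {T : H → H} (hT : FirmlyNonexpansive T) (x y : H) :
    0 ≤ (inner ℝ (T x - T y) ((x - T x) - (y - T y)) : ℝ) := by
  have h := hT x y
  rw [show (x - T x) - (y - T y) = (x - y) - (T x - T y) by abel, inner_sub_right,
    real_inner_self_eq_norm_sq]
  linarith

/-- The residual of a firmly nonexpansive operator is firmly nonexpansive. -/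
theorem FirmlyNonexpansive.id_sub {T : H → H} (hT : FirmlyNonexpansive T) :
    FirmlyNonexpansive fun x => x - T x := fun x y => by
  have h := hT x y
  rw [show (x - T x) - (y - T y) = (x - y) - (T x - T y) by abel]
  generalize T x - T y = b at *
  generalize x - y = c at *
  rw [norm_sub_sq_real, inner_sub_left, real_inner_self_eq_norm_sq]
  linarith [real_inner_comm b c]

theorem FirmlyNonexpansive.reflect {T : H → H} (hT : FirmlyNonexpansive T) (c : H) :
    FirmlyNonexpansive fun x => -T (c - x) := fun x y => by
  have := hT (c - x) (c - y)
  rw [show -T (c - x) - -T (c - y) = -(T (c - x) - T (c - y)) by abel, norm_neg, inner_neg_left,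
    ← inner_neg_right]
  rwa [show c - x - (c - y) = -(x - y) by abel] at this

/-- An intersection of closed half-spaces gives closedness and convexity at once. For the reverse
inclusion, the half-space of `w = z` already forces `‖z - T z‖² ≤ 0`. -/
theorem FirmlyNonexpansive.fixed_eq {T : H → H} (hT : FirmlyNonexpansive T) :
    {z | T z = z} = ⋂ w, {z : H | (inner ℝ (w - T w) z : ℝ) ≤ inner ℝ (w - T w) (T w)} := by
  ext z
  simp only [Set.mem_iInter, Set.mem_ofPred_eq]
  constructor
  · intro hz w
    have h := hT.inner_nonneg w z
    rw [hz, sub_self, sub_zero, inner_sub_left, real_inner_comm, real_inner_comm _ z] at h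
    linarith
  · intro h
    have h1 := h z
    rw [← sub_nonpos, ← inner_sub_right, real_inner_self_eq_norm_sq] at h1
    have h2 : ‖z - T z‖ = 0 := by nlinarith [norm_nonneg (z - T z)]
    exact (sub_eq_zero.1 (norm_eq_zero.1 h2)).symm

theorem FirmlyNonexpansive.isClosed_fixed {T : H → H} (hT : FirmlyNonexpansive T) :
    IsClosed {z | T z = z} := by
  rw [hT.fixed_eq]
  exact isClosed_iInter fun w => isClosed_le (by fun_prop) continuous_const

theorem FirmlyNonexpansive.convex_fixed {T : H → H} (hT : FirmlyNonexpansive T) :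
    Convex ℝ {z | T z = z} := by
  rw [hT.fixed_eq]
  exact convex_iInter fun w =>
    convex_halfSpace_le (IsLinearMap.mk (inner_add_right _) fun c x => inner_smul_right _ x c) _

theorem exists_projection [CompleteSpace H] {K : Set H} (hne : K.Nonempty) (hcl : IsClosed K)
    (hconv : Convex ℝ K) (a : H) : ∃ q ∈ K, ∀ w ∈ K, (inner ℝ (a - q) (w - q) : ℝ) ≤ 0 := by
  obtain ⟨q, hq, h⟩ := exists_norm_eq_iInf_of_complete_convex hne hcl.isComplete hconv a
  exact ⟨q, hq, (norm_eq_iInf_iff_real_inner_le_zero hconv hq).1 h⟩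

/-- The Douglas–Rachford operator of two resolvents. -/
def douglasRachford (J D : H → H) (z : H) : H := z - J z + D ((2 : ℝ) • J z - z)

/-- The defect in the conclusion is exactly the sum of the defects of `J` at `z, w` and of `D` at
the reflected points. -/
theorem FirmlyNonexpansive.douglasRachford {J D : H → H} (hJ : FirmlyNonexpansive J)
    (hD : FirmlyNonexpansive D) : FirmlyNonexpansive (douglasRachford J D) := by
  intro z w
  have h1 := hJ z w
  have h2 := hD ((2 : ℝ) • J z - z) ((2 : ℝ) • J w - w)
  unfold GraRED.douglasRachford
  set e := D ((2 : ℝ) • J z - z) - D ((2 : ℝ) • J w - w) with he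
  set a := J z - J w with ha
  rw [show (2 : ℝ) • J z - z - ((2 : ℝ) • J w - w) = (2 : ℝ) • a - (z - w) by rw [ha]; module,
    inner_sub_right, inner_smul_right] at h2
  rw [show z - J z + D ((2 : ℝ) • J z - z) - (w - J w + D ((2 : ℝ) • J w - w))
    = (z - w) - (a - e) by rw [ha, he]; abel]
  generalize z - w = b at *
  rw [← real_inner_self_eq_norm_sq] at h1 h2 ⊢
  simp only [inner_sub_left, inner_sub_right]
  linarith [real_inner_comm a b, real_inner_comm a e, real_inner_comm b e]

theorem douglasRachford_eq_self_iff {J D : H → H} {z : H} :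
    douglasRachford J D z = z ↔ D ((2 : ℝ) • J z - z) = J z := by
  unfold douglasRachford
  constructor
  · intro h
    rw [← sub_eq_zero] at h ⊢
    rw [← h]
    abel
  · intro h
    rw [h]
    abel

/-- Demiclosedness of the Douglas–Rachford iteration, including the shadow sequence. -/
theorem douglasRachford_demiclosed {J D : H → H} (hJ : FirmlyNonexpansive J)
    (hD : FirmlyNonexpansive D) {ι : Type*} {l : Filter ι} [l.NeBot] {x : ι → H} {C : ℝ}
    (hC : ∀ i, ‖x i‖ ≤ C) {z d : H} (hz : WeakTendsto x l z)
    (hd : WeakTendsto (fun i => J (x i)) l d)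
    (hres : Tendsto (fun i => douglasRachford J D (x i) - x i) l (𝓝 0)) :
    J z = d ∧ douglasRachford J D z = z := by
  set p := J z with hp
  set c := (2 : ℝ) • d - z with hc
  set q := D c with hq
  set r : ι → H := fun i => douglasRachford J D (x i) - x i with hr
  have hr0 : ∀ w : H, Tendsto (fun i => (inner ℝ (r i) w : ℝ)) l (𝓝 0) := fun w => by
    have := hres.inner (𝕜 := ℝ) (tendsto_const_nhds (x := w))
    rwa [inner_zero_left] at this
  have hrr : Tendsto (fun i => (inner ℝ (r i) (r i) : ℝ)) l (𝓝 0) := by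
    have := hres.inner (𝕜 := ℝ) hres
    rwa [inner_zero_left] at this
  have hrx : Tendsto (fun i => (inner ℝ (r i) (x i) : ℝ)) l (𝓝 0) := by
    refine squeeze_zero_norm (a := fun i => ‖r i‖ * C) (fun i => ?_) ?_
    · exact (norm_inner_le_norm _ _).trans (mul_le_mul_of_nonneg_left (hC i) (norm_nonneg _))
    · have := hres.norm.mul_const C
      rwa [norm_zero, zero_mul] at this
  -- Sum of the monotonicity inequalities of `J` and `D`. The products of `J (x i)` with `x i` and
  -- with itself cancel, leaving terms affine in the weakly convergent sequences and terms carrying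
  -- the vanishing residual `r i`.
  have hnn : ∀ i, 0 ≤ (inner ℝ (q - p) (x i) - inner ℝ (q - p) (J (x i)))
      - (inner ℝ (z - p) (J (x i)) - inner ℝ (z - p) p)
      - (inner ℝ (c - q) (J (x i)) - inner ℝ (c - q) q)
      - inner ℝ (r i) (x i) - inner ℝ (r i) (r i) - inner ℝ (r i) (c - q - q) := by
    intro i
    have h1 := hJ.inner_nonneg (x i) z
    have h2 := hD.inner_nonneg ((2 : ℝ) • J (x i) - x i) c
    have he : D ((2 : ℝ) • J (x i) - x i) = J (x i) + r i := by
      simp only [hr, douglasRachford]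
      abel
    rw [he, ← hq] at h2
    rw [← hp] at h1
    rw [show (2 : ℝ) • J (x i) - x i - (J (x i) + r i) - (c - q)
      = J (x i) - x i - r i - (c - q) by module] at h2
    simp only [inner_sub_left, inner_sub_right, inner_add_left] at h1 h2 ⊢
    linarith [real_inner_comm (J (x i)) (x i), real_inner_comm (J (x i)) (r i),
      real_inner_comm (x i) (r i), real_inner_comm (J (x i)) p, real_inner_comm (J (x i)) q,
      real_inner_comm (J (x i)) c, real_inner_comm (J (x i)) z, real_inner_comm (r i) p,
      real_inner_comm (r i) q, real_inner_comm (r i) c, real_inner_comm (x i) p,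
      real_inner_comm (x i) q, real_inner_comm p z, real_inner_comm q c]
  have hlim := ((((((hz (q - p)).sub (hd (q - p))).sub ((hd (z - p)).sub_const
    (inner ℝ (z - p) p))).sub ((hd (c - q)).sub_const (inner ℝ (c - q) q))).sub hrx).sub
      hrr).sub (hr0 (c - q - q))
  have h0 := ge_of_tendsto' hlim hnn
  -- With `c = 2 d - z` the limit inequality is exactly `-(‖d - p‖² + ‖d - q‖²) ≥ 0`.
  have hsum : ‖d - p‖ ^ 2 + ‖d - q‖ ^ 2 ≤ 0 := by
    rw [hc] at h0
    rw [← real_inner_self_eq_norm_sq, ← real_inner_self_eq_norm_sq]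
    simp only [inner_sub_left, inner_sub_right, inner_smul_left, conj_trivial] at h0 ⊢
    linarith [real_inner_comm d z, real_inner_comm d p, real_inner_comm d q, real_inner_comm z p,
      real_inner_comm z q, real_inner_comm p q]
  have hdp : ‖d - p‖ = 0 := by nlinarith [sq_nonneg ‖d - p‖, sq_nonneg ‖d - q‖]
  have hdq : ‖d - q‖ = 0 := by nlinarith [sq_nonneg ‖d - p‖, sq_nonneg ‖d - q‖]
  have hdp' : p = d := (sub_eq_zero.1 (norm_eq_zero.1 hdp)).symm
  have hdq' : d = q := sub_eq_zero.1 (norm_eq_zero.1 hdq)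
  refine ⟨hdp', douglasRachford_eq_self_iff.2 ?_⟩
  rw [← hp, hdp', ← hc, ← hq, hdq']

/-! ## The Krasnoselskii–Mann iteration -/

theorem FirmlyNonexpansive.norm_sub_fixed_le {T : H → H} (hT : FirmlyNonexpansive T) {w : H}
    (hw : T w = w) (z : H) {r : ℝ} (hr : 0 ≤ r) :
    ‖z + r • (T z - z) - w‖ ^ 2 ≤ ‖z - w‖ ^ 2 - r * (2 - r) * ‖T z - z‖ ^ 2 := by
  have h := hT z w
  rw [hw, show T z - w = (T z - z) + (z - w) by abel, norm_add_sq_real, inner_add_left,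
    real_inner_self_eq_norm_sq] at h
  rw [show z + r • (T z - z) - w = r • (T z - z) + (z - w) by abel, norm_add_sq_real, norm_smul,
    mul_pow, inner_smul_left, Real.norm_eq_abs, sq_abs, conj_trivial]
  nlinarith

/-- Opial's lemma along ultrafilters: if the distances to all points of `S` converge and all weak
cluster points lie in `S`, then all weak cluster points coincide. -/
theorem weak_cluster_unique {x : ℕ → H} {S : Set H}
    (hS : ∀ w ∈ S, ∃ c, Tendsto (fun k => ‖x k - w‖ ^ 2) atTop (𝓝 c)) {U V : Ultrafilter ℕ}
    (hU : ↑U ≤ (atTop : Filter ℕ)) (hV : ↑V ≤ (atTop : Filter ℕ)) {a b : H} (ha : a ∈ S)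
    (hb : b ∈ S) (hxa : WeakTendsto x U a) (hxb : WeakTendsto x V b) : a = b := by
  obtain ⟨α, hα⟩ := hS a ha
  obtain ⟨β, hβ⟩ := hS b hb
  -- The difference of the two squared distances is affine in `x k`, so this inner product converges
  -- along the whole sequence.
  have key : Tendsto (fun k => (inner ℝ (a - b) (x k) : ℝ)) atTop
      (𝓝 ((β - α + (‖a‖ ^ 2 - ‖b‖ ^ 2)) / 2)) := by
    refine (((hβ.sub hα).add_const (‖a‖ ^ 2 - ‖b‖ ^ 2)).div_const 2).congr fun k => ?_
    rw [norm_sub_sq_real, norm_sub_sq_real, inner_sub_left, real_inner_comm a, real_inner_comm b]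
    ring
  have h1 := tendsto_nhds_unique (hxa (a - b)) (key.mono_left hU)
  have h2 := tendsto_nhds_unique (hxb (a - b)) (key.mono_left hV)
  have h3 : (inner ℝ (a - b) (a - b) : ℝ) = 0 := by
    rw [inner_sub_right, h1, h2, sub_self]
  exact sub_eq_zero.1 (inner_self_eq_zero.1 h3)

/-- Convergence of the relaxed Douglas–Rachford iteration: the shadow sequence converges weakly to
the shadow of a fixed point. -/
theorem douglasRachford_weakTendsto [CompleteSpace H] {J D : H → H} (hJ : FirmlyNonexpansive J)
    (hD : FirmlyNonexpansive D) {x : ℕ → H} {r : ℕ → ℝ} {ε : ℝ} (hε : 0 < ε)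
    (hr1 : ∀ k, ε ≤ r k) (hr2 : ∀ k, r k ≤ 2 - ε)
    (hx : ∀ k, x (k + 1) = x k + r k • (douglasRachford J D (x k) - x k))
    (hfix : ∃ w, douglasRachford J D w = w) :
    ∃ z, douglasRachford J D z = z ∧ WeakTendsto (fun k => J (x k)) atTop (J z) := by
  set G := douglasRachford J D with hG
  have hGf : FirmlyNonexpansive G := hJ.douglasRachford hD
  have hfejer : ∀ w, G w = w → ∀ k, ‖x (k + 1) - w‖ ^ 2
      ≤ ‖x k - w‖ ^ 2 - ε * ε * ‖G (x k) - x k‖ ^ 2 := by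
    intro w hw k
    rw [hx k]
    refine (hGf.norm_sub_fixed_le hw (x k) (hε.le.trans (hr1 k))).trans ?_
    have h1 : ε * ε ≤ r k * (2 - r k) :=
      mul_le_mul (hr1 k) (by linarith [hr2 k]) hε.le (hε.le.trans (hr1 k))
    nlinarith [sq_nonneg ‖G (x k) - x k‖]
  have hanti : ∀ w, G w = w → Antitone fun k => ‖x k - w‖ ^ 2 := fun w hw =>
    antitone_nat_of_succ_le fun k => (hfejer w hw k).trans
      (by nlinarith [mul_nonneg (mul_nonneg hε.le hε.le) (sq_nonneg ‖G (x k) - x k‖)])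
  have hconv : ∀ w ∈ {w | G w = w}, ∃ c, Tendsto (fun k => ‖x k - w‖ ^ 2) atTop (𝓝 c) :=
    fun w hw => ⟨_, tendsto_atTop_ciInf (hanti w hw)
      ⟨0, by rintro _ ⟨k, rfl⟩; exact sq_nonneg _⟩⟩
  obtain ⟨w, hw⟩ := hfix
  have hbound : ∀ k, ‖x k - w‖ ≤ ‖x 0 - w‖ := fun k => by
    have := hanti w hw (Nat.zero_le k)
    exact (sq_le_sq₀ (norm_nonneg _) (norm_nonneg _)).1 this
  have hxb : ∀ k, ‖x k‖ ≤ ‖x 0 - w‖ + ‖w‖ := fun k => by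
    have := norm_add_le (x k - w) w
    rw [sub_add_cancel] at this
    linarith [hbound k]
  have hJb : ∀ k, ‖J (x k)‖ ≤ ‖x 0 - w‖ + ‖J w‖ := fun k => by
    have := norm_add_le (J (x k) - J w) (J w)
    rw [sub_add_cancel] at this
    linarith [hbound k, hJ.norm_sub_le (x k) w]
  have hres : Tendsto (fun k => G (x k) - x k) atTop (𝓝 0) := by
    obtain ⟨c, hc⟩ := hconv w hw
    have h1 := hc.sub ((tendsto_add_atTop_iff_nat 1).2 hc)
    rw [sub_self] at h1
    have h2 : Tendsto (fun k => ε * ε * ‖G (x k) - x k‖ ^ 2) atTop (𝓝 0) :=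
      squeeze_zero (fun k => by positivity) (fun k => by linarith [hfejer w hw k]) h1
    have h3 := (h2.const_mul (ε * ε)⁻¹).sqrt
    rw [mul_zero, Real.sqrt_zero] at h3
    refine tendsto_zero_iff_norm_tendsto_zero.2 (h3.congr fun k => ?_)
    rw [inv_mul_cancel_left₀ (mul_pos hε hε).ne', Real.sqrt_sq (norm_nonneg _)]
  have hcluster : ∀ U : Ultrafilter ℕ, ↑U ≤ (atTop : Filter ℕ) → ∃ z, G z = z ∧
      WeakTendsto x U z ∧ WeakTendsto (fun k => J (x k)) U (J z) := by
    intro U hU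
    obtain ⟨z, hz⟩ := exists_weakTendsto U hxb
    obtain ⟨d, hd⟩ := exists_weakTendsto U hJb
    -- `J` need not be weakly continuous; demiclosedness is what identifies the weak limit of the
    -- shadows as `J z`.
    obtain ⟨h1, h2⟩ := douglasRachford_demiclosed hJ hD hxb hz hd (hres.mono_left hU)
    exact ⟨z, h2, hz, h1 ▸ hd⟩
  obtain ⟨z, hz, hxz, -⟩ := hcluster (Ultrafilter.of atTop) (Ultrafilter.of_le _)
  refine ⟨z, hz, weakTendsto_iff_ultrafilter.2 fun U hU => ?_⟩
  obtain ⟨z', hz', hxz', hJz'⟩ := hcluster U hU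
  rwa [weak_cluster_unique hconv (Ultrafilter.of_le _) hU hz hz' hxz hxz']

/-! ## The Halpern iteration -/

/-- Since `1 - γ ≤ exp (-γ)`, the excess of `s` over `ε` is bounded by a multiple of `exp (-∑ γ)`,
which vanishes as the sum diverges. -/
theorem tendsto_zero_of_contraction {s γ : ℕ → ℝ} (hs : ∀ n, 0 ≤ s n)
    (hγ : ∀ n, γ n ∈ Set.Icc (0 : ℝ) 1)
    (hsum : Tendsto (fun n => ∑ k ∈ Finset.range n, γ k) atTop atTop)
    (h : ∀ ε > 0, ∀ᶠ n in atTop, s (n + 1) ≤ (1 - γ n) * s n + γ n * ε) :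
    Tendsto s atTop (𝓝 0) := by
  have key : ∀ ε > 0, ∀ᶠ n in atTop, s n < 2 * ε := by
    intro ε hε
    obtain ⟨N, hN⟩ := eventually_atTop.1 (h ε hε)
    have h1 : ∀ n ≥ N, s n - ε ≤ Real.exp (∑ k ∈ Finset.range N, γ k
        - ∑ k ∈ Finset.range n, γ k) * s N := by
      intro n hn
      induction n, hn using Nat.le_induction with
      | base => simp [hε.le]
      | succ n hn ih =>
        have h2 := hN n hn
        have h3 : 1 - γ n ≤ Real.exp (-γ n) := by linarith [Real.add_one_le_exp (-γ n)]
        have h4 : s (n + 1) - ε ≤ (1 - γ n) * (s n - ε) := by linarith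
        refine h4.trans ((mul_le_mul_of_nonneg_left ih (sub_nonneg.2 (hγ n).2)).trans ?_)
        rw [Finset.sum_range_succ, ← sub_sub, sub_eq_neg_add (_ - _) (γ n), Real.exp_add, mul_assoc]
        exact mul_le_mul_of_nonneg_right h3 (mul_nonneg (Real.exp_pos _).le (hs N))
    have h2 : Tendsto (fun n => Real.exp (∑ k ∈ Finset.range N, γ k
        - ∑ k ∈ Finset.range n, γ k) * s N) atTop (𝓝 (0 * s N)) :=
      (Real.tendsto_exp_atBot.comp (tendsto_const_nhds.add_atBot (tendsto_neg_atTop_atBot.comp hsum))).mul_const _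
    rw [zero_mul] at h2
    filter_upwards [h2.eventually (gt_mem_nhds hε), eventually_ge_atTop N] with n hn1 hn2
    linarith [h1 n hn2]
  rw [Metric.tendsto_atTop]
  intro ε hε
  obtain ⟨N, hN⟩ := eventually_atTop.1 (key (ε / 2) (half_pos hε))
  refine ⟨N, fun n hn => ?_⟩
  rw [Real.dist_eq, sub_zero, abs_of_nonneg (hs n)]
  linarith [hN n hn]

/-- Relaxed averages of a sequence inherit its weak limit. -/
theorem weakTendsto_of_relaxation {x d : ℕ → H} {r : ℕ → ℝ} {ε : ℝ} (hε : 0 < ε)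
    (hr1 : ∀ k, ε ≤ r k) (hr2 : ∀ k, r k ≤ 2 - ε)
    (hx : ∀ k, x (k + 1) = r k • d k + (1 - r k) • x k) {a : H} (hd : WeakTendsto d atTop a) :
    WeakTendsto x atTop a := by
  intro w
  have hd' : Tendsto (fun k => 2 * ‖(inner ℝ w (d k) : ℝ) - inner ℝ w a‖) atTop (𝓝 0) := by
    simpa using (tendsto_iff_norm_sub_tendsto_zero.1 (hd w)).const_mul 2
  rw [tendsto_iff_norm_sub_tendsto_zero]
  have hε1 : ε ≤ 1 := by linarith [hr1 0, hr2 0]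
  -- The scalar error is multiplied by `|1 - r k| ≤ 1 - ε` at each step and perturbed by at most
  -- twice the vanishing error of `d k`.
  refine tendsto_zero_of_contraction (γ := fun _ => ε) (fun _ => norm_nonneg _)
    (fun _ => ⟨hε.le, hε1⟩) ?_ fun η hη => ?_
  · simp only [Finset.sum_const, Finset.card_range, nsmul_eq_mul]
    exact tendsto_natCast_atTop_atTop.atTop_mul_const hε
  · filter_upwards [hd'.eventually (gt_mem_nhds (mul_pos hε hη))] with k hk
    have e : (inner ℝ w (x (k + 1)) : ℝ) - inner ℝ w a
        = r k * (inner ℝ w (d k) - inner ℝ w a) + (1 - r k) * (inner ℝ w (x k) - inner ℝ w a) := by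
      rw [hx, inner_add_right, inner_smul_right, inner_smul_right]
      ring
    rw [e]
    refine (norm_add_le _ _).trans ?_
    rw [norm_mul, norm_mul]
    have h1 : ‖r k‖ ≤ 2 := by
      rw [Real.norm_of_nonneg (hε.le.trans (hr1 k))]
      linarith [hr2 k]
    have h2 : ‖1 - r k‖ ≤ 1 - ε := by
      rw [Real.norm_eq_abs, abs_le]
      constructor <;> linarith [hr1 k, hr2 k]
    have h3 := mul_le_mul_of_nonneg_right h1 (norm_nonneg ((inner ℝ w (d k) : ℝ) - inner ℝ w a))
    have h4 := mul_le_mul_of_nonneg_right h2 (norm_nonneg ((inner ℝ w (x k) : ℝ) - inner ℝ w a))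
    linarith

/-- At each late index, either the residual `η n` is at most `θ`, so `δ n` is small and `h1`
contracts, or `s` drops by more than `θ`, which exceeds `γ n * (K + S)` and so again yields the
contraction inequality. No monotonicity of `s` is needed. -/
theorem tendsto_zero_of_halpern {s γ η δ : ℕ → ℝ} {K S : ℝ} (hs : ∀ n, 0 ≤ s n)
    (hS : ∀ n, s n ≤ S) (hγ : ∀ n, γ n ∈ Set.Icc (0 : ℝ) 1) (hγ0 : Tendsto γ atTop (𝓝 0))
    (hsum : Tendsto (fun n => ∑ k ∈ Finset.range n, γ k) atTop atTop)
    (h1 : ∀ n, s (n + 1) ≤ (1 - γ n) * s n + γ n * δ n)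
    (h2 : ∀ n, s (n + 1) ≤ s n - η n + γ n * K)
    (h3 : ∀ ε > 0, ∃ θ > 0, ∀ᶠ n in atTop, η n ≤ θ → δ n ≤ ε) :
    Tendsto s atTop (𝓝 0) := by
  refine tendsto_zero_of_contraction hs hγ hsum fun ε hε => ?_
  obtain ⟨θ, hθ, h4⟩ := h3 ε hε
  have h5 : Tendsto (fun n => γ n * (K + S)) atTop (𝓝 0) := by
    simpa using hγ0.mul_const (K + S)
  filter_upwards [h4, h5.eventually (gt_mem_nhds hθ)] with n hn1 hn2
  rcases le_or_gt (η n) θ with hη | hη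
  · exact (h1 n).trans (by linarith [mul_le_mul_of_nonneg_left (hn1 hη) (hγ n).1])
  · have := h2 n
    nlinarith [mul_le_mul_of_nonneg_left (hS n) (hγ n).1, mul_nonneg (hγ n).1 hε.le]

/-- Strong convergence of the Halpern iteration of a Douglas–Rachford operator. -/
theorem douglasRachford_halpern [CompleteSpace H] {J D : H → H} (hJ : FirmlyNonexpansive J)
    (hD : FirmlyNonexpansive D) {x : ℕ → H} {γ : ℕ → ℝ} {a q : H}
    (hγ : ∀ n, γ n ∈ Set.Icc (0 : ℝ) 1) (hγ0 : Tendsto γ atTop (𝓝 0))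
    (hsum : Tendsto (fun n => ∑ k ∈ Finset.range n, γ k) atTop atTop)
    (hx : ∀ k, x (k + 1) = γ k • a + (1 - γ k) • douglasRachford J D (x k))
    (hq : douglasRachford J D q = q)
    (hproj : ∀ w, douglasRachford J D w = w → (inner ℝ (a - q) (w - q) : ℝ) ≤ 0) :
    Tendsto x atTop (𝓝 q) := by
  set G := douglasRachford J D with hG
  have hGf : FirmlyNonexpansive G := hJ.douglasRachford hD
  have hGq : ∀ z, ‖G z - q‖ ≤ ‖z - q‖ := fun z => by
    have := hGf.norm_sub_le z q
    rwa [hq] at this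
  obtain ⟨B, hB⟩ : ∃ B, B = max ‖x 0 - q‖ ‖a - q‖ := ⟨_, rfl⟩
  have hsub : ∀ k, x (k + 1) - q = γ k • (a - q) + (1 - γ k) • (G (x k) - q) := fun k => by
    rw [hx]
    module
  have haB : ‖a - q‖ ≤ B := hB ▸ le_max_right _ _
  have hxB : ∀ k, ‖x k - q‖ ≤ B := by
    intro k
    induction k with
    | zero => exact hB ▸ le_max_left _ _
    | succ k ih =>
      rw [hsub]
      refine (norm_add_le _ _).trans ?_
      rw [norm_smul, norm_smul, Real.norm_of_nonneg (hγ k).1,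
        Real.norm_of_nonneg (sub_nonneg.2 (hγ k).2)]
      have h1 := mul_le_mul_of_nonneg_left haB (hγ k).1
      have h2 := mul_le_mul_of_nonneg_left ((hGq (x k)).trans ih) (sub_nonneg.2 (hγ k).2)
      linarith
  have hB0 : 0 ≤ B := (norm_nonneg _).trans haB
  have hrec : ∀ k, ‖x (k + 1) - q‖ ^ 2
      ≤ (1 - γ k) * ‖G (x k) - q‖ ^ 2 + γ k * (2 * inner ℝ (a - q) (x (k + 1) - q)) := by
    intro k
    have h0 := sq_nonneg ‖γ k • (a - q)‖
    have h1 : ‖x (k + 1) - q‖ ^ 2 = ‖(1 - γ k) • (G (x k) - q)‖ ^ 2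
        + 2 * inner ℝ (γ k • (a - q)) (x (k + 1) - q) - ‖γ k • (a - q)‖ ^ 2 := by
      rw [hsub, norm_add_sq_real, inner_add_right, real_inner_self_eq_norm_sq]
      ring
    rw [norm_smul, mul_pow, Real.norm_eq_abs, sq_abs, inner_smul_left, conj_trivial] at h1
    have h2 : (1 - γ k) ^ 2 * ‖G (x k) - q‖ ^ 2 ≤ (1 - γ k) * ‖G (x k) - q‖ ^ 2 := by
      refine mul_le_mul_of_nonneg_right ?_ (sq_nonneg _)
      nlinarith [(hγ k).1, (hγ k).2]
    linarith
  have hinner : ∀ k, (inner ℝ (a - q) (x k - q) : ℝ) ≤ B * B := fun k =>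
    (real_inner_le_norm _ _).trans (mul_le_mul haB (hxB k) (norm_nonneg _) hB0)
  have hGdec : ∀ k, ‖G (x k) - q‖ ^ 2 ≤ ‖x k - q‖ ^ 2 - ‖G (x k) - x k‖ ^ 2 := fun k => by
    have := hGf.norm_sub_fixed_le hq (x k) zero_le_one
    rwa [one_smul, add_sub_cancel, show (1 : ℝ) * (2 - 1) = 1 by norm_num, one_mul] at this
  have hGstep : Tendsto (fun k => x (k + 1) - G (x k)) atTop (𝓝 0) := by
    have h1 : ∀ k, x (k + 1) - G (x k) = γ k • ((a - q) - (G (x k) - q)) := fun k => by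
      rw [hx]
      module
    refine squeeze_zero_norm (a := fun k => γ k * (B + B)) (fun k => ?_) ?_
    · rw [h1, norm_smul, Real.norm_of_nonneg (hγ k).1]
      exact mul_le_mul_of_nonneg_left ((norm_sub_le _ _).trans
        (add_le_add haB ((hGq _).trans (hxB k)))) (hγ k).1
    · simpa using hγ0.mul_const (B + B)
  have hlim : Tendsto (fun k => ‖x k - q‖ ^ 2) atTop (𝓝 0) := by
    refine tendsto_zero_of_halpern (γ := γ) (η := fun k => ‖G (x k) - x k‖ ^ 2)
      (δ := fun k => 2 * inner ℝ (a - q) (x (k + 1) - q)) (K := 2 * (B * B)) (S := B ^ 2)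
      (fun _ => sq_nonneg _) (fun k => pow_le_pow_left₀ (norm_nonneg _) (hxB k) 2) hγ hγ0 hsum
      (fun k => (hrec k).trans ?_) (fun k => (hrec k).trans ?_) fun ε hε => ?_
    · have := mul_le_mul_of_nonneg_left (pow_le_pow_left₀ (norm_nonneg _) (hGq (x k)) 2)
        (sub_nonneg.2 (hγ k).2)
      linarith
    · have h1 := mul_le_mul_of_nonneg_left (hinner (k + 1)) (hγ k).1
      have h2 := mul_nonneg (hγ k).1 (sq_nonneg ‖G (x k) - q‖)
      linarith [hGdec k]
    -- Otherwise there are indices with residual tending to zero while the inner product stays above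
    -- `ε / 2`; a weak cluster point is then fixed by `G` and violates `hproj`.
    · by_contra! hcon
      have hn : ∀ m : ℕ, ∃ n ≥ m, ‖G (x n) - x n‖ ^ 2 ≤ 1 / ((m : ℝ) + 1) ∧
          ε < 2 * inner ℝ (a - q) (x (n + 1) - q) := by
        intro m
        have := hcon (1 / ((m : ℝ) + 1)) (by positivity)
        obtain ⟨n, hn, h⟩ := (frequently_atTop.1 this) m
        exact ⟨n, hn, h⟩
      choose n hnm hn1 hn2 using hn
      have hnt : Tendsto n atTop atTop := tendsto_atTop_mono hnm tendsto_id
      let U : Ultrafilter ℕ := Ultrafilter.of atTop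
      have hU : ↑U ≤ (atTop : Filter ℕ) := Ultrafilter.of_le _
      have hres : Tendsto (fun m => G (x (n m)) - x (n m)) atTop (𝓝 0) := by
        have h1 : Tendsto (fun m => ‖G (x (n m)) - x (n m)‖ ^ 2) atTop (𝓝 0) :=
          squeeze_zero (fun _ => sq_nonneg _) hn1 tendsto_one_div_add_atTop_nhds_zero_nat
        have h2 := h1.sqrt
        rw [Real.sqrt_zero] at h2
        refine tendsto_zero_iff_norm_tendsto_zero.2 (h2.congr fun m => ?_)
        rw [Real.sqrt_sq (norm_nonneg _)]
      have hxb : ∀ m, ‖x (n m)‖ ≤ B + ‖q‖ := fun m => by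
        have := norm_add_le (x (n m) - q) q
        rw [sub_add_cancel] at this
        linarith [hxB (n m)]
      have hJb : ∀ m, ‖J (x (n m))‖ ≤ B + ‖J q‖ := fun m => by
        have := norm_add_le (J (x (n m)) - J q) (J q)
        rw [sub_add_cancel] at this
        linarith [hxB (n m), hJ.norm_sub_le (x (n m)) q]
      obtain ⟨z, hz⟩ := exists_weakTendsto U hxb
      obtain ⟨d, hd⟩ := exists_weakTendsto U hJb
      obtain ⟨-, hGz⟩ := douglasRachford_demiclosed hJ hD hxb hz hd (hres.mono_left hU)
      have hstep : Tendsto (fun m => x (n m + 1) - x (n m)) atTop (𝓝 0) := by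
        have := (hGstep.comp hnt).add hres
        rw [add_zero] at this
        refine this.congr fun m => ?_
        simp only [Function.comp_apply]
        abel
      have h1 : Tendsto (fun m => (inner ℝ (a - q) (x (n m + 1) - x (n m)) : ℝ)) U (𝓝 0) := by
        have := (tendsto_const_nhds (x := a - q)).inner (𝕜 := ℝ) (hstep.mono_left hU)
        rwa [inner_zero_right] at this
      have h2 : Tendsto (fun m => 2 * (inner ℝ (a - q) (x (n m + 1) - q) : ℝ)) U
          (𝓝 (2 * inner ℝ (a - q) (z - q))) := by
        have := ((h1.add (hz (a - q))).sub_const (inner ℝ (a - q) q)).const_mul 2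
        rw [zero_add, ← inner_sub_right] at this
        refine this.congr fun m => ?_
        rw [← inner_add_right, ← inner_sub_right, sub_add_cancel]
      have h3 := ge_of_tendsto' h2 fun m => (hn2 m).le
      linarith [hproj z hGz]
  rw [tendsto_iff_norm_sub_tendsto_zero]
  have := hlim.sqrt
  rw [Real.sqrt_zero] at this
  exact this.congr fun k => Real.sqrt_sq (norm_nonneg _)

/-! ## Existence of a nonnegative implicit regularization -/

theorem map_zero_of_homogeneous {D : H → H} (hhom : ∀ c : ℝ, 0 < c → ∀ x, D (c • x) = c • D x) :
    D 0 = 0 := by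
  have h := hhom 2 two_pos 0
  rw [smul_zero, two_smul] at h
  exact left_eq_add.1 h

/-- Euler's identity for positively homogeneous maps. -/
theorem fderiv_apply_self {D : H → H} (hhom : ∀ c : ℝ, 0 < c → ∀ x, D (c • x) = c • D x) {x : H}
    (hd : DifferentiableAt ℝ D x) : fderiv ℝ D x x = D x := by
  have h1 : HasDerivAt (fun t : ℝ => t • x) x 1 := by
    simpa using (hasDerivAt_id (1 : ℝ)).smul_const x
  have h2 : HasDerivAt (fun t : ℝ => D (t • x)) (fderiv ℝ D x x) 1 := by
    have hd' : HasFDerivAt D (fderiv ℝ D x) ((1 : ℝ) • x) := by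
      rw [one_smul]
      exact hd.hasFDerivAt
    exact hd'.comp_hasDerivAt 1 h1
  have h3 : HasDerivAt (fun t : ℝ => D (t • x)) (D x) 1 := by
    have h4 : HasDerivAt (fun t : ℝ => t • D x) (D x) 1 := by
      simpa using (hasDerivAt_id (1 : ℝ)).smul_const (D x)
    refine h4.congr_of_eventuallyEq ?_
    filter_upwards [lt_mem_nhds (zero_lt_one (α := ℝ))] with t ht
    exact hhom t ht x
  exact h2.unique h3

/-- The RED gradient formula: `∇g = I - D`. -/
theorem hasFDerivAt_red {D : H → H} (hhom : ∀ c : ℝ, 0 < c → ∀ x, D (c • x) = c • D x)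
    (hres : ∀ x y, ‖(x - D x) - (y - D y)‖ ≤ ‖x - y‖)
    (hjac : ∀ x, x ≠ 0 → DifferentiableAt ℝ D x ∧ (fderiv ℝ D x).IsSymmetric) (x : H) :
    HasFDerivAt (red D) (innerSL ℝ (x - D x)) x := by
  have h0 := map_zero_of_homogeneous hhom
  rcases eq_or_ne x 0 with rfl | hx
  · rw [h0, sub_zero, map_zero]
    -- `D` may fail to be differentiable at the origin, but `red D` is bounded there by a multiple
    -- of the squared norm.
    refine Asymptotics.IsBigO.hasFDerivAt (n := 2) ?_ one_lt_two
    refine Asymptotics.IsBigO.of_bound 1 (Eventually.of_forall fun z => ?_)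
    have h1 : ‖z - D z‖ ≤ ‖z‖ := by
      have := hres z 0
      rwa [h0, sub_zero, sub_zero, sub_zero] at this
    rw [sub_zero, red, one_mul, norm_mul, norm_pow, norm_norm, Real.norm_of_nonneg (by norm_num)]
    have h2 := (norm_inner_le_norm (𝕜 := ℝ) z (z - D z)).trans
      (mul_le_mul_of_nonneg_left h1 (norm_nonneg z))
    nlinarith [sq_nonneg ‖z‖]
  · obtain ⟨hd, hsym⟩ := hjac x hx
    have h1 := ((hasFDerivAt_id x).inner ℝ ((hasFDerivAt_id x).sub hd.hasFDerivAt)).const_mul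
      (1 / 2 : ℝ)
    refine h1.congr_fderiv ?_
    ext v
    -- Symmetry moves the derivative onto `x`, where Euler's identity evaluates it.
    have h2 : (inner ℝ x (fderiv ℝ D x v) : ℝ) = inner ℝ (D x) v := by
      rw [← fderiv_apply_self hhom hd]
      exact (hsym x v).symm
    simp only [smul_apply, ContinuousLinearMap.comp_apply,
      ContinuousLinearMap.prod_apply, fderivInnerCLM_apply, sub_apply, Pi.sub_apply,
      ContinuousLinearMap.id_apply, id_eq, smul_eq_mul, innerSL_apply_apply, inner_sub_right,
      inner_sub_left, h2]
    rw [real_inner_comm v (D x), real_inner_comm v x]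
    ring

/-- The gradient inequality for `½‖·‖² - red D`: along a segment, the derivative of the gap is
nonnegative by monotonicity of `D`. -/
theorem half_sq_sub_red_ge {D : H → H} (hhom : ∀ c : ℝ, 0 < c → ∀ x, D (c • x) = c • D x)
    (hres : ∀ x y, ‖(x - D x) - (y - D y)‖ ≤ ‖x - y‖)
    (hjac : ∀ x, x ≠ 0 → DifferentiableAt ℝ D x ∧ (fderiv ℝ D x).IsSymmetric) (x w : H) :
    1 / 2 * ‖x‖ ^ 2 - red D x + inner ℝ (D x) (w - x) ≤ 1 / 2 * ‖w‖ ^ 2 - red D w := by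
  have hmono : ∀ y, 0 ≤ (inner ℝ (D y - D x) (y - x) : ℝ) := by
    intro y
    have h1 := hres y x
    have h2 := real_inner_le_norm ((y - D y) - (x - D x)) (y - x)
    have h3 : (inner ℝ (D y - D x) (y - x) : ℝ)
        = ‖y - x‖ ^ 2 - inner ℝ ((y - D y) - (x - D x)) (y - x) := by
      rw [show (y - D y) - (x - D x) = (y - x) - (D y - D x) by abel, inner_sub_left (y - x),
        real_inner_self_eq_norm_sq]
      ring
    nlinarith [mul_le_mul_of_nonneg_right h1 (norm_nonneg (y - x))]
  set u := w - x with hu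
  have hline : ∀ t : ℝ, HasDerivAt (fun t : ℝ => x + t • u) u t := fun t => by
    simpa using ((hasDerivAt_id t).smul_const u).const_add x
  have hder : ∀ t : ℝ, HasDerivAt (fun t : ℝ => 1 / 2 * ‖x + t • u‖ ^ 2 - red D (x + t • u)
      - t * inner ℝ (D x) u) (inner ℝ (D (x + t • u) - D x) u) t := by
    intro t
    have h1 := ((hline t).norm_sq).const_mul (1 / 2 : ℝ)
    have h2 := (hasFDerivAt_red hhom hres hjac (x + t • u)).comp_hasDerivAt t (hline t)
    have h3 := (h1.sub h2).sub ((hasDerivAt_id t).mul_const (inner ℝ (D x) u : ℝ))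
    refine h3.congr_deriv ?_
    rw [innerSL_apply_apply, inner_sub_left, inner_sub_left]
    ring
  have hmon := monotoneOn_of_deriv_nonneg (convex_Icc (0 : ℝ) 1)
    (fun t _ => (hder t).continuousAt.continuousWithinAt)
    (fun t _ => (hder t).differentiableAt.differentiableWithinAt) (fun t ht => by
      rw [interior_Icc] at ht
      rw [(hder t).deriv]
      have h1 := hmono (x + t • u)
      rw [add_sub_cancel_left, inner_smul_right] at h1
      exact nonneg_of_mul_nonneg_right h1 ht.1)
  have := hmon (Set.left_mem_Icc.2 zero_le_one) (Set.right_mem_Icc.2 zero_le_one) zero_le_one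
  simp only [zero_smul, add_zero, one_smul, zero_mul, one_mul, sub_zero] at this
  rw [hu, add_sub_cancel, ← hu] at this
  linarith

/-- `red D` is homogeneous of degree two, so convexity between `0` and `x` reads `red D x / 4 ≤ red
D x / 2`. -/
theorem red_nonneg {D : H → H} (hhom : ∀ c : ℝ, 0 < c → ∀ x, D (c • x) = c • D x)
    (hred : ConvexOn ℝ Set.univ (red D)) (x : H) : 0 ≤ red D x := by
  have h := hred.2 (Set.mem_univ x) (Set.mem_univ 0) (by norm_num : (0 : ℝ) ≤ 1 / 2)
    (by norm_num : (0 : ℝ) ≤ 1 / 2) (by norm_num)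
  have h0 : red D 0 = 0 := by simp [red]
  have h1 : red D ((1 / 2 : ℝ) • x) = 1 / 4 * red D x := by
    rw [red, red, hhom _ (by norm_num), ← smul_sub, inner_smul_left, inner_smul_right, conj_trivial]
    ring
  rw [smul_zero, add_zero, h0, h1, smul_eq_mul, smul_zero, add_zero] at h
  linarith

/-- The deconvolution of the RED functional by the half squared norm. -/
noncomputable def redReg (D : H → H) (u : H) : EReal :=
  ⨆ v : H, ((red D (u + v) - 1 / 2 * ‖v‖ ^ 2 : ℝ) : EReal)

theorem redReg_le_iff {D : H → H} {u : H} {t : ℝ} :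
    redReg D u ≤ t ↔ ∀ v, red D (u + v) - 1 / 2 * ‖v‖ ^ 2 ≤ t := by
  rw [redReg, iSup_le_iff]
  exact forall_congr' fun v => EReal.coe_le_coe_iff

theorem conj_ne_top_of_mem_subdiff {f : H → EReal} (hbot : ∀ x, f x ≠ ⊥) (htop : ∃ x, f x ≠ ⊤)
    {x v : H} (hv : v ∈ subdiff f x) : conj f v ≠ ⊤ := by
  obtain ⟨a, ha⟩ := exists_real_of_mem_subdiff hbot htop hv
  rw [conj_eq_of_mem_subdiff hbot ha hv]
  exact EReal.coe_ne_top _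

/-- Moreau's decomposition for the conjugate. -/
theorem IsProperConvexLsc.isProx_conj {f : H → EReal} (hf : IsProperConvexLsc f) {x p : H}
    (h : IsProx f x p) : IsProx (conj f) x (x - p) := by
  have h1 := h.mem_subdiff hf.ne_bot hf.exists_ne_top hf.convex_epigraph
  refine isProx_of_mem_subdiff (conj_ne_bot hf.ne_bot hf.exists_ne_top)
    ⟨_, conj_ne_top_of_mem_subdiff hf.ne_bot hf.exists_ne_top h1⟩ ?_
  rw [sub_sub_cancel]
  exact mem_subdiff_conj hf.ne_bot hf.exists_ne_top h1

theorem exists_isImplicitReg {D : H → H} (hhom : ∀ c : ℝ, 0 < c → ∀ x, D (c • x) = c • D x)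
    (hres : ∀ x y, ‖(x - D x) - (y - D y)‖ ≤ ‖x - y‖)
    (hjac : ∀ x, x ≠ 0 → DifferentiableAt ℝ D x ∧ (fderiv ℝ D x).IsSymmetric)
    (hred : ConvexOn ℝ Set.univ (red D)) :
    ∃ φ : H → EReal, (∀ x, 0 ≤ φ x) ∧ IsImplicitReg D φ := by
  have hnonneg : ∀ u, 0 ≤ redReg D u := fun u => by
    refine le_iSup_of_le 0 ?_
    rw [add_zero, norm_zero]
    have := red_nonneg hhom hred u
    exact_mod_cast (by linarith : (0 : ℝ) ≤ red D u - 1 / 2 * 0 ^ 2)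
  -- The supremum is attained at `v = x - D x`; the gradient inequality at `x` bounds every other
  -- `v`.
  have hval : ∀ x, redReg D (D x) = (red D x - 1 / 2 * ‖x - D x‖ ^ 2 : ℝ) := fun x => by
    apply le_antisymm
    · rw [redReg_le_iff]
      intro v
      have h := half_sq_sub_red_ge hhom hres hjac x (D x + v)
      rw [norm_add_sq_real, inner_sub_right, inner_add_right, real_inner_self_eq_norm_sq] at h
      rw [norm_sub_sq_real, real_inner_comm]
      linarith
    · refine le_iSup_of_le (x - D x) ?_
      rw [add_sub_cancel]
  have hproper : IsProperConvexLsc (redReg D) :=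
    { ne_bot := fun x h => by
        have := hnonneg x
        rw [h] at this
        exact absurd this (by simp)
      exists_ne_top := ⟨D 0, by rw [hval]; exact EReal.coe_ne_top _⟩
      convex_epigraph := by
        rintro ⟨x, s⟩ hx ⟨y, t⟩ hy a b ha hb hab
        simp only [Set.mem_ofPred_eq, redReg_le_iff, Prod.fst_add, Prod.smul_fst, Prod.snd_add,
          Prod.smul_snd, smul_eq_mul] at hx hy ⊢
        intro v
        have h1 := hred.2 (Set.mem_univ (x + v)) (Set.mem_univ (y + v)) ha hb hab
        rw [show a • (x + v) + b • (y + v) = a • x + b • y + (a + b) • v by module, hab, one_smul,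
          smul_eq_mul, smul_eq_mul] at h1
        have h2 : (a + b) * (1 / 2 * ‖v‖ ^ 2) = 1 / 2 * ‖v‖ ^ 2 := by rw [hab, one_mul]
        have h3 := mul_le_mul_of_nonneg_left (hx v) ha
        have h4 := mul_le_mul_of_nonneg_left (hy v) hb
        linarith
      lsc := by
        have hc : Continuous (red D) := continuous_iff_continuousAt.2 fun x =>
          (hasFDerivAt_red hhom hres hjac x).continuousAt
        exact lowerSemicontinuous_iSup fun v =>
          (continuous_coe_real_ereal.comp (by fun_prop)).lowerSemicontinuous }
  have hprox : ∀ x, IsProx (redReg D) x (D x) := fun x => by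
    rw [isProx_iff hproper.ne_bot (hval x)]
    intro z t ht
    -- The choice `v = x - z` bounds the proximal objective below by `red D x`, its value at `D x`.
    have h := redReg_le_iff.1 ht.le (x - z)
    rw [add_sub_cancel, norm_sub_rev] at h
    rw [norm_sub_rev (D x)]
    linarith
  exact ⟨redReg D, hnonneg, hproper, fun x => hproper.isProx_conj (hprox x), hprox⟩

/-! ## Resolvents of subdifferentials -/

theorem firmlyNonexpansive_of_sub_mem_subdiff {f : H → EReal} (hbot : ∀ x, f x ≠ ⊥)
    (htop : ∃ x, f x ≠ ⊤) {T : H → H} (hT : ∀ x, x - T x ∈ subdiff f (T x)) :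
    FirmlyNonexpansive T := by
  intro x y
  have h := subdiff_monotone hbot htop (hT x) (hT y)
  rw [show x - T x - (y - T y) = (x - y) - (T x - T y) by abel, inner_sub_left,
    real_inner_self_eq_norm_sq, real_inner_comm] at h
  linarith

theorem mem_subdiff_iff_resolvent {f : H → EReal} (hbot : ∀ x, f x ≠ ⊥) (htop : ∃ x, f x ≠ ⊤)
    {T : H → H} (hT : ∀ x, x - T x ∈ subdiff f (T x)) {x v : H} :
    v ∈ subdiff f x ↔ T (x + v) = x := by
  constructor
  · intro h
    refine eq_of_mem_subdiff hbot htop (hT (x + v)) ?_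
    rwa [add_sub_cancel_left]
  · intro h
    have := hT (x + v)
    rwa [h, add_sub_cancel_left] at this

theorem IsImplicitReg.sub_mem_subdiff {D : H → H} {φ : H → EReal} (h : IsImplicitReg D φ) (x : H) :
    x - D x ∈ subdiff φ (D x) :=
  (h.denoiser_prox x).mem_subdiff h.proper.ne_bot h.proper.exists_ne_top h.proper.convex_epigraph

theorem IsImplicitReg.firmlyNonexpansive {D : H → H} {φ : H → EReal} (h : IsImplicitReg D φ) :
    FirmlyNonexpansive D :=
  firmlyNonexpansive_of_sub_mem_subdiff h.proper.ne_bot h.proper.exists_ne_top h.sub_mem_subdiff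

theorem IsImplicitReg.mem_subdiff_iff {D : H → H} {φ : H → EReal} (h : IsImplicitReg D φ)
    {x y : H} : y ∈ subdiff φ x ↔ D (x + y) = x :=
  mem_subdiff_iff_resolvent h.proper.ne_bot h.proper.exists_ne_top h.sub_mem_subdiff

/-- Uniqueness of the resolvent of `conj φ` at `x + y` inverts the subdifferential without
biconjugation. -/
theorem IsImplicitReg.mem_subdiff_conj_iff {D : H → H} {φ : H → EReal} (h : IsImplicitReg D φ)
    {x y : H} : x ∈ subdiff (conj φ) y ↔ D (x + y) = x := by
  have hb := h.proper.ne_bot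
  have ht := h.proper.exists_ne_top
  constructor
  · intro hx
    have h1 := h.sub_mem_subdiff (x + y)
    have h2 := mem_subdiff_conj hb ht h1
    have h3 := eq_of_mem_subdiff (conj_ne_bot hb ht) ⟨_, conj_ne_top_of_mem_subdiff hb ht h1⟩
      (x := x + y) (p := x + y - D (x + y)) (q := y) (by rwa [sub_sub_cancel])
      (by rwa [add_sub_cancel_right])
    rw [sub_eq_iff_eq_add, add_comm y] at h3
    exact (add_right_cancel h3).symm
  · intro hx
    exact mem_subdiff_conj hb ht (h.mem_subdiff_iff.2 hx)

/-! ## Saddle points -/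

/-- The pairs `(x, y)` with `x = J (x - y)` and `x = D (x + y)`. -/
def IsSaddle (J D : H → H) (x y : H) : Prop := J (x - y) = x ∧ D (x + y) = x

theorem zero_mem_opA_iff [CompleteSpace H] {D : H → H} {φ f : H → EReal} (hφ : IsImplicitReg D φ)
    (hf : IsProperConvexLsc f) {lam : ℝ} (hlam : 0 < lam) {u : WithLp 2 (H × H)} :
    0 ∈ opA lam f φ u ↔ IsSaddle (prox fun z => (lam : EReal) * f z) D u.fst u.snd := by
  have hF := hf.smul hlam
  rw [IsSaddle, ← hφ.mem_subdiff_conj_iff, sub_eq_add_neg, ← mem_subdiff_iff_resolvent hF.ne_bot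
    hF.exists_ne_top hF.sub_prox_mem_subdiff]
  constructor
  · rintro ⟨p, hp, q, hq, h⟩
    have h1 : lam • p + u.snd = 0 := (congrArg WithLp.fst h).symm
    have h2 : -u.fst + q = 0 := (congrArg WithLp.snd h).symm
    rw [← eq_neg_of_add_eq_zero_left h1, smul_mem_subdiff_iff hf hlam]
    rw [neg_add_eq_zero] at h2
    exact ⟨hp, h2 ▸ hq⟩
  · rintro ⟨h1, h2⟩
    refine ⟨lam⁻¹ • -u.snd, ?_, u.fst, h2, ?_⟩
    · rwa [← smul_mem_subdiff_iff hf hlam, smul_inv_smul₀ hlam.ne']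
    · rw [smul_inv_smul₀ hlam.ne', neg_add_cancel, neg_add_cancel]
      rfl

/-- `M u` cancels, so the preconditioner affects only the seminorm and not the fixed points. -/
theorem mem_fixSet_opT_iff {E : Type*} [AddCommGroup E] {A : E → Set E} {M : E → E} {u : E} :
    u ∈ fixSet (opT A M) ↔ 0 ∈ A u := by
  constructor
  · rintro ⟨w, hw, h⟩
    rwa [left_eq_add.1 h] at hw
  · exact fun h => ⟨0, h, (add_zero _).symm⟩

theorem IsSaddle.fixed {J D : H → H} {x y : H} (h : IsSaddle J D x y) :
    douglasRachford J D (x - y) = x - y := by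
  rw [douglasRachford_eq_self_iff, h.1, show (2 : ℝ) • x - (x - y) = x + y by module, h.2]

theorem isSaddle_of_fixed {J D : H → H} {z : H} (h : douglasRachford J D z = z) :
    IsSaddle J D (J z) (J z - z) := by
  rw [douglasRachford_eq_self_iff] at h
  refine ⟨by rw [sub_sub_cancel], ?_⟩
  rw [show J z + (J z - z) = (2 : ℝ) • J z - z by module, h]

/-- The saddle points of a convex-concave problem form a product set. -/
theorem IsSaddle.exchange {J D : H → H} {F φ : H → EReal} (hF : IsProperConvexLsc F)
    (hJ : ∀ x, x - J x ∈ subdiff F (J x)) (hφ : IsImplicitReg D φ) {x₁ y₁ x₂ y₂ : H}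
    (h₁ : IsSaddle J D x₁ y₁) (h₂ : IsSaddle J D x₂ y₂) : IsSaddle J D x₁ y₂ := by
  simp only [IsSaddle, sub_eq_add_neg, ← hφ.mem_subdiff_iff,
    ← mem_subdiff_iff_resolvent hF.ne_bot hF.exists_ne_top hJ] at h₁ h₂ ⊢
  have h3 := subdiff_monotone hF.ne_bot hF.exists_ne_top h₁.1 h₂.1
  have h4 := subdiff_monotone hφ.proper.ne_bot hφ.proper.exists_ne_top h₁.2 h₂.2
  have h5 : (inner ℝ (-y₁ - -y₂) (x₁ - x₂) : ℝ) = -inner ℝ (y₁ - y₂) (x₁ - x₂) := by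
    rw [← inner_neg_left]
    congr 1
    abel
  rw [h5] at h3
  -- The two monotonicity inequalities have opposite signs; equality lets paramonotonicity exchange
  -- the components.
  have h6 : (inner ℝ (y₁ - y₂) (x₁ - x₂) : ℝ) = 0 := le_antisymm (by linarith) h4
  exact ⟨mem_subdiff_of_inner_eq_zero hF.ne_bot hF.exists_ne_top h₁.1 h₂.1 (by rw [h5, h6, neg_zero]),
    mem_subdiff_of_inner_eq_zero hφ.proper.ne_bot hφ.proper.exists_ne_top h₁.2 h₂.2 h6⟩

/-- Scaling the first pair by `1 + t` and applying monotonicity against the second leaves `t ⟨(1 +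
t) x₁ - x₂, y⟩ ≥ 0`; dividing by `t` and letting `t → 0` gives one sign, and exchanging the points
gives the other. -/
theorem inner_sub_eq_zero_of_homogeneous {D : H → H} (hD : FirmlyNonexpansive D)
    (hhom : ∀ c : ℝ, 0 < c → ∀ x, D (c • x) = c • D x) {x₁ x₂ y : H} (h₁ : D (x₁ + y) = x₁)
    (h₂ : D (x₂ + y) = x₂) : (inner ℝ (x₁ - x₂) y : ℝ) = 0 := by
  have key : ∀ {x₁ x₂ : H}, D (x₁ + y) = x₁ → D (x₂ + y) = x₂ →
      0 ≤ (inner ℝ (x₁ - x₂) y : ℝ) := by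
    intro x₁ x₂ h₁ h₂
    refine nonneg_of_forall_small (k := inner ℝ x₁ y) fun t ht _ => ?_
    have h := hD.inner_nonneg ((1 + t) • (x₁ + y)) (x₂ + y)
    rw [hhom _ (by linarith), h₁, h₂, show (1 + t) • (x₁ + y) - (1 + t) • x₁ - (x₂ + y - x₂)
      = t • y by module, inner_smul_right] at h
    have h' := nonneg_of_mul_nonneg_right h ht
    rwa [show (1 + t) • x₁ - x₂ = (x₁ - x₂) + t • x₁ by module, inner_add_left, inner_smul_left,
      conj_trivial] at h'
  refine le_antisymm ?_ (key h₁ h₂)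
  have := key h₂ h₁
  rw [← neg_sub, inner_neg_left] at this
  linarith

/-- Each defining equation says that `y` is a fixed point of a firmly nonexpansive map built from
the residual of `J` or `D`. -/
theorem isClosed_and_convex_isSaddle {J D : H → H} (hJ : FirmlyNonexpansive J)
    (hD : FirmlyNonexpansive D) (x : H) :
    IsClosed {y | IsSaddle J D x y} ∧ Convex ℝ {y | IsSaddle J D x y} := by
  have h1 := hJ.id_sub.reflect x
  have h2 := hD.id_sub.sub_const (-x)
  have h3 : {y | IsSaddle J D x y}
      = {y | -(x - y - J (x - y)) = y} ∩ {y | y - -x - D (y - -x) = y} := by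
    ext y
    simp only [IsSaddle, Set.mem_inter_iff, Set.mem_ofPred_eq]
    refine and_congr ?_ ?_
    · rw [neg_eq_iff_eq_neg, sub_eq_iff_eq_add, sub_eq_neg_add, add_right_inj, eq_comm]
    · rw [sub_neg_eq_add, add_comm y x, sub_eq_iff_eq_add, add_comm x y, add_right_inj, eq_comm]
  rw [h3]
  exact ⟨h1.isClosed_fixed.inter h2.isClosed_fixed, h1.convex_fixed.inter h2.convex_fixed⟩

/-- The projection of `a` onto `{x - τ y}` over saddle points `(x, y)`: its `x`-component is the
shadow of the projection of `a` onto the fixed points of the Douglas–Rachford operator. -/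
theorem exists_saddle_projection [CompleteSpace H] {J D : H → H} {F φ : H → EReal}
    (hF : IsProperConvexLsc F) (hJ : ∀ x, x - J x ∈ subdiff F (J x)) (hφ : IsImplicitReg D φ)
    (hhom : ∀ c : ℝ, 0 < c → ∀ x, D (c • x) = c • D x) {τ s : ℝ} (hτs : τ * s = 1)
    {a q : H} (hq : douglasRachford J D q = q)
    (hproj : ∀ w, douglasRachford J D w = w → (inner ℝ (a - q) (w - q) : ℝ) ≤ 0) :
    ∃ y₀, IsSaddle J D (J q) y₀ ∧ ∀ x y, IsSaddle J D x y →
      ‖J q - τ • y₀ - a‖ ^ 2 + ‖x - J q‖ ^ 2 + τ ^ 2 * ‖y - y₀‖ ^ 2 ≤ ‖x - τ • y - a‖ ^ 2 := by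
  have hJf := firmlyNonexpansive_of_sub_mem_subdiff hF.ne_bot hF.exists_ne_top hJ
  have hDf := hφ.firmlyNonexpansive
  have hsq := isSaddle_of_fixed hq
  obtain ⟨hcl, hcv⟩ := isClosed_and_convex_isSaddle hJf hDf (J q)
  -- Minimizing `‖τ y + a‖` over the dual set means projecting `-a / τ = -(s • a)`.
  obtain ⟨y₀, hy₀, hy₀p⟩ := exists_projection (K := {y | IsSaddle J D (J q) y}) ⟨_, hsq⟩ hcl hcv
    (-(s • a))
  refine ⟨y₀, hy₀, fun x y hxy => ?_⟩
  have hRhom : ∀ c : ℝ, 0 < c → ∀ x, c • x - D (c • x) = c • (x - D x) := fun c hc x => by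
    rw [hhom c hc, smul_sub]
  have hinner : ∀ {x' y'}, IsSaddle J D x' y' → (inner ℝ (x - x') y' : ℝ) = 0 := fun h' =>
    inner_sub_eq_zero_of_homogeneous hDf hhom (hxy.exchange hF hJ hφ h').2 h'.2
  have hinner' : ∀ {x'}, IsSaddle J D x' y₀ → (inner ℝ (y - y₀) x' : ℝ) = 0 := fun {x'} h' => by
    refine inner_sub_eq_zero_of_homogeneous hDf.id_sub hRhom ?_ ?_
    · rw [add_comm, (h'.exchange hF hJ hφ hxy).2, add_sub_cancel_left]
    · rw [add_comm, h'.2, add_sub_cancel_left]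
  have e1 := hinner hy₀
  have e2 := hinner hsq
  have e3 := hinner' hy₀
  have e4 := hinner' (hxy.exchange hF hJ hφ hy₀)
  have i1 := hproj _ (hxy.exchange hF hJ hφ hsq).fixed
  have i2 := hy₀p y (hy₀.exchange hF hJ hφ hxy)
  rw [show x - (J q - q) - q = x - J q by abel, show a - q = (a - J q) + (J q - q) by abel,
    inner_add_left, real_inner_comm _ (J q - q), e2, add_zero] at i1
  have i3 : 0 ≤ τ ^ 2 * inner ℝ (s • a + y₀) (y - y₀) := by
    refine mul_nonneg (sq_nonneg _) ?_
    rw [show -(s • a) - y₀ = -(s • a + y₀) by abel, inner_neg_left] at i2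
    linarith
  rw [inner_add_left, inner_smul_left, conj_trivial] at i3
  have i4 : τ ^ 2 * (s * inner ℝ a (y - y₀)) = τ * inner ℝ a (y - y₀) := by
    rw [← mul_assoc, sq, mul_assoc τ τ s, hτs, mul_one]
  rw [mul_add, i4] at i3
  have e5 : (inner ℝ (x - J q) (y - y₀) : ℝ) = 0 := by
    rw [inner_sub_left, real_inner_comm _ x, real_inner_comm _ (J q), e3, e4, sub_zero]
  -- The two increments are orthogonal by `e5`. The cross terms with the base point are nonnegative
  -- by `i1` and `i3`, since `e1` and `e3` remove the mixed primal-dual products.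
  have hexp : x - τ • y - a = (J q - τ • y₀ - a) + ((x - J q) - τ • (y - y₀)) := by module
  rw [hexp, norm_add_sq_real, norm_sub_sq_real (x - J q), norm_smul, mul_pow, Real.norm_eq_abs,
    sq_abs, inner_smul_right, e5, inner_sub_right, inner_smul_right,
    show J q - τ • y₀ - a = J q - a - τ • y₀ by abel, inner_sub_left (J q - a),
    inner_sub_left (J q - a), inner_smul_left, inner_smul_left, conj_trivial,
    real_inner_comm (x - J q) y₀, e1, inner_sub_left (J q) a (y - y₀), real_inner_comm (y - y₀) (J q),
    e3]
  rw [show a - J q = -(J q - a) by abel, inner_neg_left] at i1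
  linarith

/-! ## The preconditioner and the reduced iterations -/

/-- With `τ s = 1` the form is degenerate: it is a perfect square seeing only `x - τ y`. -/
theorem seminormM_opM {τ s : ℝ} (hτs : τ * s = 1)
    (u : WithLp 2 (H × H)) :
    seminormM (opM τ s) u = Real.sqrt (s * ‖u.fst - τ • u.snd‖ ^ 2) := by
  have h1 : τ⁻¹ = s := inv_eq_of_mul_eq_one_right hτs
  have h2 : s⁻¹ = τ := by rw [← h1, inv_inv]
  rw [seminormM, opM, h1, h2, WithLp.prod_inner_apply, norm_sub_sq_real, norm_smul, mul_pow,
    Real.norm_eq_abs, sq_abs, inner_smul_right]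
  congr 1
  change (inner ℝ (s • u.fst - u.snd) u.fst + inner ℝ (-u.fst + τ • u.snd) u.snd : ℝ) = _
  rw [inner_sub_left, inner_add_left, inner_neg_left, inner_smul_left, inner_smul_left,
    conj_trivial, conj_trivial, real_inner_self_eq_norm_sq, real_inner_self_eq_norm_sq,
    real_inner_comm u.fst u.snd]
  linear_combination (2 * inner ℝ u.fst u.snd - τ * ‖u.snd‖ ^ 2) * hτs

theorem smul_residual {D : H → H} (hhom : ∀ c : ℝ, 0 < c → ∀ x, D (c • x) = c • D x) {τ s : ℝ}
    (hτ : 0 < τ) (hτs : τ * s = 1) {w x y d : H} (hw : w = y + s • ((2 : ℝ) • d - x)) :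
    τ • (w - D w) = ((2 : ℝ) • d - (x - τ • y)) - D ((2 : ℝ) • d - (x - τ • y)) := by
  have h : τ • w = (2 : ℝ) • d - (x - τ • y) := by
    rw [hw, smul_add, smul_smul, hτs, one_smul]
    abel
  rw [smul_sub, ← hhom τ hτ, h]

theorem IsGraREDP3.reduced {D : H → H} {f : H → EReal} {lam τ s : ℝ} {r : ℕ → ℝ} {x y : ℕ → H}
    (h : IsGraREDP3 D f lam τ s r x y) (hhom : ∀ c : ℝ, 0 < c → ∀ x, D (c • x) = c • D x)
    (hτ : 0 < τ) (hτs : τ * s = 1) (k : ℕ) :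
    x (k + 1) - τ • y (k + 1) = (x k - τ • y k) + r k •
      (douglasRachford (prox fun z => (lam : EReal) * f z) D (x k - τ • y k)
        - (x k - τ • y k)) := by
  obtain ⟨d, hd, hx, hy⟩ := h k
  have hr := smul_residual hhom hτ hτs (x := x k) (y := y k) (d := d) rfl
  rw [hx, hy, smul_add, smul_comm τ (r k), hr, douglasRachford, ← hd]
  module

theorem IsGraREDHP3.reduced {D : H → H} {f : H → EReal} {lam τ s : ℝ} {μ : ℕ → ℝ} {xa ya : H}
    {x y : ℕ → H} (h : IsGraREDHP3 D f lam τ s μ xa ya x y)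
    (hhom : ∀ c : ℝ, 0 < c → ∀ x, D (c • x) = c • D x) (hτ : 0 < τ) (hτs : τ * s = 1) (k : ℕ) :
    x (k + 1) - τ • y (k + 1) = μ (k + 1) • (xa - τ • ya) + (1 - μ (k + 1)) •
      douglasRachford (prox fun z => (lam : EReal) * f z) D (x k - τ • y k) := by
  obtain ⟨d, v, hd, hx, hv, hy⟩ := h k
  have hr := smul_residual hhom hτ hτs (x := x k) (y := y k) (d := d) (add_comm (s • _) (y k))
  rw [← hv] at hr
  rw [hx, hy, smul_add, smul_comm τ (1 - μ (k + 1)) v, hr, douglasRachford, ← hd]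
  module

theorem graREDP3_converges [CompleteSpace H] {D : H → H}
    (hhom : ∀ c : ℝ, 0 < c → ∀ x, D (c • x) = c • D x) {φ f : H → EReal} (hφ : IsImplicitReg D φ)
    (hf : IsProperConvexLsc f) {lam τ s : ℝ} (hlam : 0 < lam) (hτ : 0 < τ) (hτs : τ * s = 1)
    (hsol : ∃ u, 0 ∈ opA lam f φ u) {r : ℕ → ℝ} {x y : ℕ → H}
    (hr : ∀ k, r k ∈ Set.Icc (0 : ℝ) 2) (hinf : 0 < ⨅ k, r k) (hsup : ⨆ k, r k < 2)
    (h : IsGraREDP3 D f lam τ s r x y) :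
    ∃ xstar, IsSolution lam f φ xstar ∧ WeakTendsto x atTop xstar := by
  have hF := hf.smul hlam
  have hJ := firmlyNonexpansive_of_sub_mem_subdiff hF.ne_bot hF.exists_ne_top
    hF.sub_prox_mem_subdiff
  obtain ⟨ε, hε, hr1, hr2⟩ : ∃ ε > 0, (∀ k, ε ≤ r k) ∧ ∀ k, r k ≤ 2 - ε := by
    refine ⟨min (⨅ k, r k) (2 - ⨆ k, r k), lt_min hinf (sub_pos.2 hsup), fun k => ?_, fun k => ?_⟩
    -- The bounds `0` and `2` ensure that the real infimum and supremum are genuine, not default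
    -- values.
    · exact (min_le_left _ _).trans (ciInf_le ⟨0, by rintro _ ⟨j, rfl⟩; exact (hr j).1⟩ k)
    · have h1 : r k ≤ ⨆ k, r k := le_ciSup ⟨2, by rintro _ ⟨j, rfl⟩; exact (hr j).2⟩ k
      have h2 := min_le_right (⨅ k, r k) (2 - ⨆ k, r k)
      linarith
  obtain ⟨u, hu⟩ := hsol
  obtain ⟨z, hz, hzlim⟩ := douglasRachford_weakTendsto hJ hφ.firmlyNonexpansive
    (x := fun k => x k - τ • y k) hε hr1 hr2 (h.reduced hhom hτ hτs)
    ⟨_, ((zero_mem_opA_iff hφ hf hlam).1 hu).fixed⟩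
  refine ⟨_, ?_, weakTendsto_of_relaxation hε hr1 hr2 (fun k => ?_) hzlim⟩
  · refine isSolution_of_mem_subdiff hlam hf hφ.proper (hF.sub_prox_mem_subdiff z) ?_
    rw [neg_sub]
    exact hφ.mem_subdiff_iff.2 (isSaddle_of_fixed hz).2
  · obtain ⟨d, hd, hx, -⟩ := h k
    rw [hx, hd]

theorem graREDHP3_converges [CompleteSpace H] {D : H → H}
    (hhom : ∀ c : ℝ, 0 < c → ∀ x, D (c • x) = c • D x) {φ f : H → EReal} (hφ : IsImplicitReg D φ)
    (hf : IsProperConvexLsc f) {lam τ s : ℝ} (hlam : 0 < lam) (hτ : 0 < τ) (hs : 0 < s)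
    (hτs : τ * s = 1) (hsol : ∃ u, 0 ∈ opA lam f φ u) {μ : ℕ → ℝ} {xa ya : H} {x y : ℕ → H}
    (hμ : ∀ k, μ k ∈ Set.Icc (0 : ℝ) 1) (hμ0 : Tendsto μ atTop (𝓝 0))
    (hsum : Tendsto (fun n => ∑ k ∈ Finset.range n, μ k) atTop atTop)
    (h : IsGraREDHP3 D f lam τ s μ xa ya x y) :
    ∃ p, IsMProj (opM τ s) (fixSet (opT (opA lam f φ) (opM τ s))) (WithLp.toLp 2 (xa, ya)) p ∧
      0 ∈ opA lam f φ p ∧ Tendsto x atTop (𝓝 p.fst) := by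
  have hF := hf.smul hlam
  set J := prox fun z => (lam : EReal) * f z with hJdef
  have hJm := hF.sub_prox_mem_subdiff
  rw [← hJdef] at hJm
  have hJ := firmlyNonexpansive_of_sub_mem_subdiff hF.ne_bot hF.exists_ne_top hJm
  have hD := hφ.firmlyNonexpansive
  have hG := hJ.douglasRachford hD
  set a := xa - τ • ya with ha
  obtain ⟨u, hu⟩ := hsol
  obtain ⟨q, hq, hproj⟩ := exists_projection
    (K := {z | douglasRachford J D z = z}) ⟨_, ((zero_mem_opA_iff hφ hf hlam).1 hu).fixed⟩
    hG.isClosed_fixed hG.convex_fixed a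
  obtain ⟨y₀, hy₀, hmin⟩ := exists_saddle_projection hF hJm hφ hhom hτs hq hproj
  have hμ0' : Tendsto (fun k => μ (k + 1)) atTop (𝓝 0) := (tendsto_add_atTop_iff_nat 1).2 hμ0
  have hsum' : Tendsto (fun n => ∑ k ∈ Finset.range n, μ (k + 1)) atTop atTop := by
    have h1 := tendsto_atTop_add_const_right _ (-μ 0) ((tendsto_add_atTop_iff_nat 1).2 hsum)
    refine h1.congr fun n => ?_
    rw [Finset.sum_range_succ', add_neg_cancel_right]
  have hlim : Tendsto (fun k => x k - τ • y k) atTop (𝓝 q) :=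
    douglasRachford_halpern hJ hD (γ := fun k => μ (k + 1)) (fun k => hμ (k + 1)) hμ0' hsum'
      (h.reduced hhom hτ hτs) hq hproj
  have hsemi : ∀ v : WithLp 2 (H × H), seminormM (opM τ s) (v - WithLp.toLp 2 (xa, ya))
      = Real.sqrt (s * ‖v.fst - τ • v.snd - a‖ ^ 2) := fun v => by
    rw [seminormM_opM hτs]
    congr 4
    change v.fst - xa - τ • (v.snd - ya) = _
    rw [ha]
    module
  have hmem : ∀ {v}, v ∈ fixSet (opT (opA lam f φ) (opM τ s)) ↔ IsSaddle J D v.fst v.snd :=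
    mem_fixSet_opT_iff.trans (zero_mem_opA_iff hφ hf hlam)
  refine ⟨WithLp.toLp 2 (J q, y₀), ⟨⟨hmem.2 hy₀, fun v hv => ?_⟩, fun v hv hvmin => ?_⟩,
    (zero_mem_opA_iff hφ hf hlam).2 hy₀, ?_⟩
  · rw [hsemi, hsemi]
    refine Real.sqrt_le_sqrt (mul_le_mul_of_nonneg_left ?_ hs.le)
    change ‖J q - τ • y₀ - a‖ ^ 2 ≤ _
    have := hmin _ _ (hmem.1 hv)
    nlinarith [sq_nonneg ‖v.fst - J q‖, mul_nonneg (sq_nonneg τ) (sq_nonneg ‖v.snd - y₀‖)]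
  · have h1 := hvmin (WithLp.toLp 2 (J q, y₀)) (hmem.2 hy₀)
    rw [hsemi, hsemi, Real.sqrt_le_sqrt_iff (by positivity)] at h1
    have h2 : ‖v.fst - τ • v.snd - a‖ ^ 2 ≤ ‖J q - τ • y₀ - a‖ ^ 2 := le_of_mul_le_mul_left h1 hs
    have h3 := hmin _ _ (hmem.1 hv)
    have h4 := mul_nonneg (sq_nonneg τ) (sq_nonneg ‖v.snd - y₀‖)
    have h5 : ‖v.fst - J q‖ ^ 2 = 0 := by linarith [sq_nonneg ‖v.fst - J q‖]
    -- Uniqueness survives the degeneracy of `M` because `hmin` carries the squared distances of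
    -- both components.
    have h6 : τ ^ 2 * ‖v.snd - y₀‖ ^ 2 = 0 := by linarith [sq_nonneg ‖v.fst - J q‖]
    have h7 : ‖v.snd - y₀‖ ^ 2 = 0 := (mul_eq_zero.1 h6).resolve_left (pow_pos hτ 2).ne'
    have h8 : v.fst = J q := sub_eq_zero.1 (norm_eq_zero.1 (pow_eq_zero_iff two_ne_zero |>.1 h5))
    have h9 : v.snd = y₀ := sub_eq_zero.1 (norm_eq_zero.1 (pow_eq_zero_iff two_ne_zero |>.1 h7))
    rw [← h8, ← h9]
    rfl
  · rw [← tendsto_add_atTop_iff_nat 1]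
    have h1 := hJ.tendsto hlim
    have h2 := (hμ0'.smul_const xa).add ((hμ0'.const_sub 1).smul h1)
    rw [zero_smul, zero_add, sub_zero, one_smul] at h2
    refine h2.congr fun k => ?_
    obtain ⟨d, v, hd, hx, -⟩ := h k
    rw [hx, hd]

end GraRED

theorem theorem3p5 {H : Type*} [NormedAddCommGroup H] [InnerProductSpace ℝ H] [CompleteSpace H]
    (D : H → H)
    (hhom : ∀ c : ℝ, 0 < c → ∀ x, D (c • x) = c • D x)
    (hres : ∀ x y, ‖(x - D x) - (y - D y)‖ ≤ ‖x - y‖)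
    (hjac : ∀ x, x ≠ 0 → DifferentiableAt ℝ D x ∧ (fderiv ℝ D x).IsSymmetric)
    (hred : ConvexOn ℝ Set.univ (GraRED.red D)) :
    (∃ φ : H → EReal, (∀ x, 0 ≤ φ x) ∧ GraRED.IsImplicitReg D φ) ∧
    ∀ φ : H → EReal, GraRED.IsImplicitReg D φ →
    ∀ f : H → EReal, GraRED.IsProperConvexLsc f →
    ∀ lam τ s : ℝ, 0 < lam → 0 < τ → 0 < s → τ * s = 1 →
    (∃ u, 0 ∈ GraRED.opA lam f φ u) →
      (∀ (r : ℕ → ℝ) (x y : ℕ → H), (∀ k, r k ∈ Set.Icc (0 : ℝ) 2) →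
        0 < ⨅ k, r k → ⨆ k, r k < 2 →
        GraRED.IsGraREDP3 D f lam τ s r x y →
        ∃ xstar, GraRED.IsSolution lam f φ xstar ∧
          (∀ w, Tendsto (fun k => (inner ℝ w (x k) : ℝ)) atTop (𝓝 (inner ℝ w xstar))) ∧
          (FiniteDimensional ℝ H → Tendsto x atTop (𝓝 xstar))) ∧
      (∀ (μ : ℕ → ℝ) (xa ya : H) (x y : ℕ → H), (∀ k, μ k ∈ Set.Icc (0 : ℝ) 1) →
        Tendsto μ atTop (𝓝 0) →
        Tendsto (fun n => ∑ k ∈ Finset.range n, μ k) atTop atTop →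
        GraRED.IsGraREDHP3 D f lam τ s μ xa ya x y →
        ∃ p, GraRED.IsMProj (GraRED.opM τ s)
            (GraRED.fixSet (GraRED.opT (GraRED.opA lam f φ) (GraRED.opM τ s)))
            (WithLp.toLp 2 (xa, ya)) p ∧
          0 ∈ GraRED.opA lam f φ p ∧
          Tendsto x atTop (𝓝 p.fst)) := by
  refine ⟨GraRED.exists_isImplicitReg hhom hres hjac hred, ?_⟩
  intro φ hφ f hf lam τ s hlam hτ hs hτs hsol
  refine ⟨fun r x y hr hinf hsup h => ?_, fun μ xa ya x y hμ hμ0 hsum h =>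
    GraRED.graREDHP3_converges hhom hφ hf hlam hτ hs hτs hsol hμ hμ0 hsum h⟩
  obtain ⟨xstar, h1, h2⟩ :=
    GraRED.graREDP3_converges hhom hφ hf hlam hτ hτs hsol hr hinf hsup h
  exact ⟨xstar, h1, h2, fun _ => GraRED.WeakTendsto.tendsto h2⟩
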